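/- Let a group $G$ act by simplicial automorphisms on a simplicial complex $X$ whose geometric realization $|X|$ is simply connected (in particular non-empty and path connected). Assume that $G$ acts without rotations, that is, for every simplex $s$ of $X$, every element of $G$ that maps $s$ to itself fixes every vertex of $s$. Assume moreover that the quotient space $X/G$ (the space of $G$-orbits in $|X|$, with the quotient topology) is $2$-connected, i.e. non-empty and path connected with $\pi_1(X/G)=0$ and $\pi_2(X/G)=0$. For a vertex $v$ of $X$ and an element $g$ of its stabilizer $G_v$, write $g_v$ for $g$ regarded as an element of the factor $G_v$ of the free product $\ast_{v\in X^{(0)}} G_v$ of the stabilizers of all the vertices of $X$. Let $R$ be the normal subgroup of this free product generated by 1. the edge relations $g_v = g_{v'}$, for all pairs of vertices $v,v'$ joined by an edge $e$ of $X$ and all $g\in G$ that stabilize $e$ (such a $g$ lies in $G_v$ and in $G_{v'}$, as the action is without rotations); and 2. the conjugation relations $g_v h_w g_v^{-1} = (ghg^{-1})_{g(w)}$, for all vertices $v,w$ of $X$ and all $g\in G_v$ and $h\in G_w$. Then the canonical homomorphism $\ast_{v\in X^{(0)}} G_v \to G$, $g_v\mapsto g$, induces an isomorphism $$\Big(\mathop{\ast}_{v\in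 X^{(0)}} G_v\Big)\Big/R \;\cong\; G.$$ -/

import Mathlib

open scoped Topology

noncomputable section

namespace AbstractSimplicialComplex

variable {V : Type*}

/-- The geometric realization `|X|` of an abstract simplicial complex `X` with vertex set `V`:
its points are the formal convex combinations of vertices whose support is a simplex of `X`
(barycentric coordinates). -/
@[ext]
structure Realization (X : AbstractSimplicialComplex V) where
  /-- the barycentric coordinates -/
  coord : V →₀ ℝ
  nonneg : ∀ v, 0 ≤ coord v
  sum_eq_one : (coord.sum fun _ t => t) = 1
  support_mem : coord.support ∈ X.faces

/-- The characteristic map of a simplex `s` of `X`, from the standard simplex with vertex set `s`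
to `|X|`: barycentric coordinates on `s` are extended by `0` to the other vertices. -/
def Realization.ofSimplex (X : AbstractSimplicialComplex V) (s : X.faces)
    (p : stdSimplex ℝ (s : Finset V)) : X.Realization where
  coord := (Finsupp.equivFunOnFinite.symm p.1).embDomain
    (Function.Embedding.subtype (· ∈ (s : Finset V)))
  nonneg v := by
    by_cases hv : v ∈ (s : Finset V)
    · have := Finsupp.embDomain_apply_self (Function.Embedding.subtype (· ∈ (s : Finset V)))
        (Finsupp.equivFunOnFinite.symm p.1) ⟨v, hv⟩
      simp only [Function.Embedding.subtype_apply] at this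
      rw [this]
      exact p.2.1 _
    · rw [Finsupp.embDomain_of_notMem_range]
      simpa using hv
  sum_eq_one := by
    rw [Finsupp.sum_embDomain, Finsupp.sum_fintype _ _ (fun _ => rfl)]
    exact p.2.2
  support_mem := by
    refine (X.isRelLowerSet_faces s.2).2 ?_ ?_
    · intro v hv
      rw [Finsupp.support_embDomain, Finset.mem_map] at hv
      obtain ⟨w, -, rfl⟩ := hv
      exact w.2
    · rw [Finsupp.support_embDomain, Finset.map_nonempty, Finsupp.support_nonempty_iff]
      intro h
      have h1 := p.2.2
      have h0 : p.1 = 0 := by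
        ext i
        exact DFunLike.congr_fun h i
      rw [h0] at h1
      simp at h1

/-- The weak (coherent) topology on `|X|`: a set is open if and only if its preimage in every
simplex of `X` is open. -/
instance (X : AbstractSimplicialComplex V) : TopologicalSpace X.Realization :=
  ⨆ s : X.faces, TopologicalSpace.coinduced (Realization.ofSimplex X s) inferInstance

variable (G : Type*) [Group G] [MulAction G V]

/-- The action of `G` on the vertex set `V` is an action on the simplicial complex `X`: every
element of `G` maps simplices to simplices. -/
class IsSimplicialAction (X : AbstractSimplicialComplex V) : Prop where
  map_mem : ∀ (g : G), ∀ s ∈ X.faces, s.map (MulAction.toPerm g).toEmbedding ∈ X.faces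

/-- The action is without rotations: whoever stabilizes a simplex `s` of `X` (as a set)
stabilizes `s` pointwise. -/
def WithoutRotations (X : AbstractSimplicialComplex V) : Prop :=
  ∀ s ∈ X.faces, ∀ g : G, s.map (MulAction.toPerm g).toEmbedding = s → ∀ v ∈ s, g • v = v

/-- The action on `|X|` that extends the action on the vertices linearly over every simplex. -/
instance (X : AbstractSimplicialComplex V) [IsSimplicialAction G X] :
    MulAction G X.Realization where
  smul g x :=
    { coord := Finsupp.equivMapDomain (MulAction.toPerm g) x.coord
      nonneg := fun v => by
        rw [Finsupp.equivMapDomain_apply]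
        exact x.nonneg _
      sum_eq_one := by
        rw [Finsupp.sum_equivMapDomain]
        exact x.sum_eq_one
      support_mem := IsSimplicialAction.map_mem g _ x.support_mem }
  one_smul x := by
    refine Realization.ext (Finsupp.ext fun v => ?_)
    change x.coord ((1 : G)⁻¹ • v) = x.coord v
    rw [inv_one, one_smul]
  mul_smul g h x := by
    refine Realization.ext (Finsupp.ext fun v => ?_)
    change x.coord ((g * h)⁻¹ • v) = x.coord (h⁻¹ • g⁻¹ • v)
    rw [mul_inv_rev, mul_smul]

/-- The quotient space `X/G`, i.e. the set of `G`-orbits in `|X|` with the quotient topology. -/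
abbrev OrbitSpace (X : AbstractSimplicialComplex V) [IsSimplicialAction G X] : Type _ :=
  MulAction.orbitRel.Quotient G X.Realization

variable (V) in
/-- The free product of the stabilizers `G_v`, over all vertices `v`. -/
abbrev StabilizerProduct : Type _ :=
  Monoid.CoprodI fun v : V => MulAction.stabilizer G v

variable {G}

/-- `g_v`: the element `g` of `G_v`, considered as an element of the free product. -/
abbrev stabElt (v : V) (g : MulAction.stabilizer G v) : StabilizerProduct V G :=
  Monoid.CoprodI.of (M := fun v : V => MulAction.stabilizer G v) (i := v) g

/-- For `h` in `G_w`, the element `g h g⁻¹` of `G_{g(w)}`. -/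
def conjStab (g : G) (w : V) (h : MulAction.stabilizer G w) : MulAction.stabilizer G (g • w) :=
  ⟨g * h * g⁻¹, by
    rw [MulAction.mem_stabilizer_iff, smul_smul, inv_mul_cancel_right, mul_smul]
    exact congrArg (g • ·) h.2⟩

variable (G)

/-- The edge relators `g_v (g_{v'})⁻¹`, where `v` and `v'` are the two vertices of an edge `e` of
`X` and `g` stabilizes `e`. (If the action is without rotations, then `g` automatically lies
in `G_v` and in `G_{v'}`.) -/
def edgeRelators (X : AbstractSimplicialComplex V) : Set (StabilizerProduct V G) :=
  {r | ∃ e ∈ X.faces, e.card = 2 ∧ ∃ v ∈ e, ∃ v' ∈ e, v ≠ v' ∧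
    ∃ g : G, e.map (MulAction.toPerm g).toEmbedding = e ∧
    ∃ (hv : g ∈ MulAction.stabilizer G v) (hv' : g ∈ MulAction.stabilizer G v'),
      r = stabElt v ⟨g, hv⟩ * (stabElt v' ⟨g, hv'⟩)⁻¹}

variable (V) in
/-- The conjugation relators `g_v h_w g_v⁻¹ ((g h g⁻¹)_{g(w)})⁻¹`, for all vertices `v`, `w` and
all `g` in `G_v` and `h` in `G_w`. -/
def conjugationRelators : Set (StabilizerProduct V G) :=
  {r | ∃ (v w : V) (g : MulAction.stabilizer G v) (h : MulAction.stabilizer G w),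
    r = stabElt v g * stabElt w h * (stabElt v g)⁻¹ *
      (stabElt ((g : G) • w) (conjStab (g : G) w h))⁻¹}

/-- The normal subgroup `R` generated by the edge relations and the conjugation relations. -/
def relatorSubgroup (X : AbstractSimplicialComplex V) : Subgroup (StabilizerProduct V G) :=
  Subgroup.normalClosure (edgeRelators G X ∪ conjugationRelators V G)

instance (X : AbstractSimplicialComplex V) : (relatorSubgroup G X).Normal :=
  Subgroup.normalClosure_normal

end AbstractSimplicialComplex

/-- A space is `2`-connected if it is non-empty and path connected with trivial fundamental group
(these three are `SimplyConnectedSpace`) and its second homotopy group is trivial. -/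
structure IsTwoConnected (Y : Type*) [TopologicalSpace Y] : Prop where
  simplyConnected : SimplyConnectedSpace Y
  pi_two : ∀ y : Y, Subsingleton (π_ 2 Y y)

end

open AbstractSimplicialComplex

/-! Write Γ for the quotient of the free product and φ : Γ → G for the canonical map. Both halves
are Čech arguments for the cover of |X| by the sets `baryStar s`. Its index set of simplices is
permuted by G, a star is equal to or disjoint from each of its translates, and stars that meet
belong to comparable simplices. Functions are only followed along paths and homotopies, so no local
connectivity enters.

Surjectivity: the image N of φ is normal and contains every simplex stabilizer, so there is an
equivariant map f from the simplices to G/N. The quotients f(s)⁻¹f(t) are G-invariant and descend to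
a locally constant 1-cocycle on X/G, that is, to a covering. Since X/G is simply connected the
cocycle is trivial, and f can be corrected to an equivariant function on |X| that is constant along
paths; hence N = G (`IsSliceCover.map_eq_one`).

Injectivity: the conjugation relations make K = ker φ central, and the edge relations give
compatible splittings of φ over the simplex stabilizers. Their failure to glue is recorded by a
cocycle ε on Γ, which is the identity on K, and a cochain τ on pairs of simplices
(`exists_splitting_cochains`). On meeting stars the coboundary of τ is G-invariant, so it descends
to a locally constant 2-cocycle on X/G. Transgression turns this into a 1-cocycle on the loop space,
which is simply connected because X/G is 2-connected, so the covering argument applies again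
(`exists_loop_trivialization`). For a path from x₀ to gx₀, the resulting function of the loop below,
plus the sum of τ over the label changes, depends neither on the labelling nor, as |X| is simply
connected, on the path; call it B(g). A generator of Γ fixes a vertex, and a detour through that
vertex shows that B(φγ) − ε γ s₀ is unchanged when γ is multiplied by the generator
(`IsSliceCover.exists_holonomy`). This expression is therefore constant in γ; on k ∈ K it is B(1) −
k, so K is trivial. -/

/-! ### Coverings, Čech 1-cocycles and the loop space -/

/-- A covering map onto a simply connected space has a set-theoretic section through any given
point which is continuous along all paths. -/
theorem IsCoveringMap.exists_section_continuous_along_paths {E Z : Type*} [TopologicalSpace E]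
    [TopologicalSpace Z] [SimplyConnectedSpace Z] {p : E → Z} (cov : IsCoveringMap p) (e₀ : E) :
    ∃ σ : Z → E, (∀ z, p (σ z) = z) ∧ ∀ ω : C(unitInterval, Z), Continuous (σ ∘ ω) := by
  -- The path component of `e₀` meets every fibre, by path lifting, and by `huniq` only once, by
  -- homotopy lifting. The section picks that point.
  have hex : ∀ z, ∃ e, Joined e₀ e ∧ p e = z := fun z => by
    obtain ⟨γ⟩ := PathConnectedSpace.joined (p e₀) z
    refine ⟨cov.liftPath γ e₀ γ.source 1, ⟨⟨cov.liftPath γ e₀ γ.source,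
      cov.liftPath_zero .., rfl⟩⟩, ?_⟩
    exact (congrFun (cov.liftPath_lifts γ e₀ γ.source) 1).trans γ.target
  have huniq : ∀ e e', Joined e₀ e → Joined e₀ e' → p e = p e' → e = e' := by
    rintro e e' ⟨α⟩ ⟨β⟩ h
    have hh : ((α.map cov.continuous).cast rfl rfl).Homotopic
        ((β.map cov.continuous).cast rfl h) :=
      SimplyConnectedSpace.paths_homotopic _ _
    have h1 := cov.liftPath_apply_one_eq_of_homotopicRel hh e₀ (by simp) (by simp)
    have h2 := (cov.eq_liftPath_iff' (γ := ((α.map cov.continuous).cast rfl rfl))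
      (e := e₀) (γ_0 := by simp) (Γ := α)).2 ⟨rfl, by simp⟩
    have h3 := (cov.eq_liftPath_iff' (γ := ((β.map cov.continuous).cast rfl h))
      (e := e₀) (γ_0 := by simp) (Γ := β)).2 ⟨rfl, by simp⟩
    have h4 : (α : C(unitInterval, E)) 1 = (β : C(unitInterval, E)) 1 :=
      (DFunLike.congr_fun h2 1).trans (h1.trans (DFunLike.congr_fun h3 1).symm)
    simpa using h4
  choose σ hσ hpσ using hex
  refine ⟨σ, hpσ, fun ω => ?_⟩
  have hl := cov.liftPath_lifts ω (σ (ω 0)) (hpσ _).symm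
  have h0 := cov.liftPath_zero ω (σ (ω 0)) (hpσ _).symm
  set Ω := cov.liftPath ω (σ (ω 0)) (hpσ _).symm
  have : σ ∘ ω = Ω := by
    funext t
    refine huniq _ _ (hσ _) ((hσ (ω 0)).trans ?_) ((hpσ _).trans (congrFun hl t).symm)
    rw [← h0]
    have : PathConnectedSpace unitInterval := isPathConnected_iff_pathConnectedSpace.1
      ((convex_Icc (0 : ℝ) 1).isPathConnected ⟨0, by simp⟩)
    exact ⟨(PathConnectedSpace.somePath (0 : unitInterval) t).map Ω.continuous⟩
  rw [this]
  exact Ω.continuous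

/-- A locally constant Čech `1`-cocycle on a simply connected space is a coboundary of functions
that are locally constant along paths. -/
theorem exists_cech_trivialization {Z ι Q : Type*} [TopologicalSpace Z] [SimplyConnectedSpace Z]
    [Group Q] (U : ι → Set Z) (hU : ∀ i, IsOpen (U i)) (hcov : ∀ z, ∃ i, z ∈ U i)
    (a : ι → ι → Z → Q)
    (hloc : ∀ i j z, z ∈ U i → z ∈ U j → ∀ᶠ z' in 𝓝 z, a i j z' = a i j z)
    (hmul : ∀ i j k z, z ∈ U i → z ∈ U j → z ∈ U k → a i j z * a j k z = a i k z) :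
    ∃ b : ι → Z → Q, (∀ i j z, z ∈ U i → z ∈ U j → b i z * a i j z = b j z) ∧
      ∀ (ω : C(unitInterval, Z)) i t, ω t ∈ U i → ∀ᶠ t' in 𝓝 t, b i (ω t') = b i (ω t) := by
  let _ : TopologicalSpace Q := ⊥
  have : DiscreteTopology Q := ⟨rfl⟩
  choose idx hidx using hcov
  -- The bundle with discrete fibre `Q` glued by right multiplication with `a` is a covering; `b i`
  -- is its section read in the chart `i`.
  let C : FiberBundleCore ι Z Q :=
    { baseSet := U
      isOpen_baseSet := hU
      indexAt := idx
      mem_baseSet_at := hidx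
      coordChange := fun i j z q => q * a i j z
      coordChange_self := fun i z hz q => by
        have := hmul i i i z hz hz hz
        rw [mul_eq_left] at this
        rw [this, mul_one]
      continuousOn_coordChange := fun i j => by
        rintro ⟨z, q⟩ ⟨⟨hi, hj⟩, -⟩
        refine ContinuousAt.continuousWithinAt ?_
        have h1 : ∀ᶠ w : Z × Q in 𝓝 (z, q), a i j w.1 = a i j z :=
          (continuous_fst.tendsto (z, q)).eventually (hloc i j z hi hj)
        have h2 : ∀ᶠ w : Z × Q in 𝓝 (z, q), w.2 = q :=
          (continuous_snd.tendsto (z, q)).eventually (p := fun w => w = q)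
            (by simp [nhds_discrete])
        refine continuousAt_const.congr (f := fun _ => q * a i j z) ?_
        filter_upwards [h1, h2] with w e1 e2
        rw [e1, e2]
      coordChange_comp := fun i j k z hz q => by
        rw [mul_assoc, hmul i j k z hz.1.1 hz.1.2 hz.2] }
  have cov : IsCoveringMap C.proj := FiberBundle.isCoveringMap (F := Q) (E := C.Fiber)
  obtain ⟨z₀⟩ := (inferInstance : Nonempty Z)
  obtain ⟨σ, hσ, hc⟩ := cov.exists_section_continuous_along_paths ⟨z₀, (1 : Q)⟩
  refine ⟨fun i z => (C.localTriv i (σ z)).2, fun i j z hi hj => ?_, fun ω i t ht => ?_⟩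
  · have h := hσ z
    simp only [FiberBundleCore.localTriv_apply]
    change (show Q from (σ z).2) * a (idx (C.proj (σ z))) i (C.proj (σ z)) * a i j z =
      (show Q from (σ z).2) * a (idx (C.proj (σ z))) j (C.proj (σ z))
    rw [h, mul_assoc, hmul _ _ _ _ (hidx _) hi hj]
  · have h1 : ContinuousAt (fun t => (C.localTriv i (σ (ω t))).2) t := by
      refine continuousAt_snd.comp (ContinuousAt.comp (f := σ ∘ ω) (g := C.localTriv i)
        ?_ (hc ω).continuousAt)
      refine (C.localTriv i).continuousAt ?_
      simp only [FiberBundleCore.mem_localTriv_source]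
      change C.proj (σ (ω t)) ∈ U i
      rwa [hσ]
    exact h1.eventually (p := fun q => q = (C.localTriv i (σ (ω t))).2) (by simp [nhds_discrete])

/-- The loop space of a `2`-connected space is simply connected. -/
theorem IsTwoConnected.simplyConnectedSpace_path {Y : Type*} [TopologicalSpace Y]
    (hY : IsTwoConnected Y) (y : Y) : SimplyConnectedSpace (Path y y) := by
  have := hY.simplyConnected
  have hpc : PathConnectedSpace (Path y y) := by
    refine ⟨⟨Path.refl y⟩, fun p q => ?_⟩
    obtain ⟨H⟩ := SimplyConnectedSpace.paths_homotopic p q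
    refine ⟨⟨⟨H.eval, ?_⟩, by simp, by simp⟩⟩
    refine Path.continuous_uncurry_iff.1 ?_
    exact H.continuous
  -- π₂ is the fundamental group of the space of loops in the remaining coordinates. Only one
  -- coordinate remains, so this space is `Path y y`.
  let N := {j : Fin 2 // j ≠ 0}
  let _ : Unique N := ⟨⟨⟨1, by simp⟩⟩, fun ⟨j, hj⟩ => by
    fin_cases j
    · simp at hj
    · rfl⟩
  let e : GenLoop N Y y ≃ₜ Path y y :=
    { genLoopEquivOfUnique N with
      continuous_toFun := by
        refine Path.continuous_uncurry_iff.1 ?_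
        change Continuous fun w : GenLoop N Y y × unitInterval => w.1 fun _ => w.2
        fun_prop
      continuous_invFun := by
        refine Continuous.subtype_mk (ContinuousMap.continuous_of_continuous_uncurry _ ?_) _
        change Continuous fun w : Path y y × (N → unitInterval) => w.1 (w.2 default)
        fun_prop }
  suffices h : SimplyConnectedSpace (GenLoop N Y y) from
    e.symm.toHomotopyEquiv.simplyConnectedSpace
  have hpc' : PathConnectedSpace (GenLoop N Y y) :=
    e.symm.surjective.pathConnectedSpace e.symm.continuous
  have := hY.pi_two y
  have hs : Subsingleton (FundamentalGroup (GenLoop N Y y) GenLoop.const) :=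
    (homotopyGroupEquivFundamentalGroup (0 : Fin 2)).symm.injective.subsingleton
  refine simply_connected_iff_loops_nullhomotopic.2 ⟨hpc', fun x γ => ?_⟩
  have hx : Subsingleton (FundamentalGroup (GenLoop N Y y) x) :=
    (FundamentalGroup.fundamentalGroupMulEquivOfPathConnected
      x GenLoop.const).injective.subsingleton
  exact Path.Homotopic.Quotient.eq.1 (hx.elim (Path.Homotopic.Quotient.mk γ : _)
    (Path.Homotopic.Quotient.mk (Path.refl x)))

/-! ### The realization, its barycentric stars and the action -/

namespace AbstractSimplicialComplex

variable {V : Type*} (X : AbstractSimplicialComplex V)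

namespace Realization

variable {X}

theorem ofSimplex_coord_mem (s : X.faces) (p : stdSimplex ℝ (s : Finset V)) {v : V}
    (hv : v ∈ (s : Finset V)) : (ofSimplex X s p).coord v = p.1 ⟨v, hv⟩ :=
  Finsupp.embDomain_apply_self (Function.Embedding.subtype (· ∈ (s : Finset V)))
    (Finsupp.equivFunOnFinite.symm p.1) ⟨v, hv⟩

theorem ofSimplex_coord_notMem (s : X.faces) (p : stdSimplex ℝ (s : Finset V)) {v : V}
    (hv : v ∉ (s : Finset V)) : (ofSimplex X s p).coord v = 0 :=
  Finsupp.embDomain_of_notMem_range _ _ _ (by simpa using hv)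

theorem continuous_ofSimplex_coord (s : X.faces) (v : V) :
    Continuous fun p : stdSimplex ℝ (s : Finset V) => (ofSimplex X s p).coord v := by
  by_cases hv : v ∈ (s : Finset V)
  · simp_rw [ofSimplex_coord_mem s _ hv]
    exact (continuous_apply _).comp continuous_subtype_val
  · simp_rw [ofSimplex_coord_notMem s _ hv]
    exact continuous_const

theorem continuous_ofSimplex (s : X.faces) : Continuous (ofSimplex X s) :=
  continuous_iSup_rng (i := s) continuous_coinduced_rng

theorem continuous_of_comp_ofSimplex {Z : Type*} [TopologicalSpace Z] {f : X.Realization → Z}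
    (h : ∀ s : X.faces, Continuous (f ∘ ofSimplex X s)) : Continuous f :=
  continuous_iSup_dom.2 fun s => continuous_coinduced_dom.2 (h s)

theorem isOpen_of_preimage_ofSimplex {A : Set X.Realization}
    (h : ∀ s : X.faces, IsOpen (ofSimplex X s ⁻¹' A)) : IsOpen A :=
  isOpen_iSup_iff.2 fun s => isOpen_coinduced.2 (h s)

end Realization

/-- The open star of the barycenter of `s` in the barycentric subdivision: the points all of whose
coordinates at vertices of `s` are positive and larger than those at the other vertices. -/
def baryStar (s : X.faces) : Set X.Realization :=
  {x | ∀ v ∈ (s : Finset V), 0 < x.coord v ∧ ∀ w ∉ (s : Finset V), x.coord w < x.coord v}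

variable {X}

theorem isOpen_baryStar (s : X.faces) : IsOpen (X.baryStar s) := by
  classical
  refine Realization.isOpen_of_preimage_ofSimplex fun t => ?_
  -- On the simplex `t` finitely many conditions suffice: coordinates outside `t` vanish, and there
  -- the comparison is just positivity.
  have : Realization.ofSimplex X t ⁻¹' X.baryStar s =
      ⋂ v ∈ (s : Finset V), ({p | 0 < (Realization.ofSimplex X t p).coord v} ∩
        ⋂ w ∈ (t : Finset V).filter (· ∉ (s : Finset V)),
          {p | (Realization.ofSimplex X t p).coord w < (Realization.ofSimplex X t p).coord v}) := by
    ext p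
    simp only [baryStar, Set.mem_preimage, Set.mem_ofPred_eq, Set.mem_iInter, Set.mem_inter_iff,
      Finset.mem_filter]
    refine forall₂_congr fun v hv => and_congr_right fun hpos => ⟨fun h w hw => h w hw.2,
      fun h w hw => ?_⟩
    by_cases hwt : w ∈ (t : Finset V)
    · exact h w ⟨hwt, hw⟩
    · rwa [Realization.ofSimplex_coord_notMem t p hwt]
  rw [this]
  refine isOpen_biInter_finset fun v _ => IsOpen.inter ?_ (isOpen_biInter_finset fun w _ => ?_)
  · exact isOpen_lt continuous_const (Realization.continuous_ofSimplex_coord t v)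
  · exact isOpen_lt (Realization.continuous_ofSimplex_coord t w)
      (Realization.continuous_ofSimplex_coord t v)

theorem mem_baryStar_support (x : X.Realization) :
    x ∈ X.baryStar ⟨x.coord.support, x.support_mem⟩ := by
  intro v hv
  have hv' : 0 < x.coord v := lt_of_le_of_ne (x.nonneg v) (Finsupp.mem_support_iff.1 hv).symm
  refine ⟨hv', fun w hw => ?_⟩
  rwa [Finsupp.notMem_support_iff.1 hw]

/-- Vertices in `s \ t` and in `t \ s` would each have the strictly larger coordinate. -/
theorem subset_or_subset_of_mem_baryStar {s t : X.faces} {x : X.Realization}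
    (hs : x ∈ X.baryStar s) (ht : x ∈ X.baryStar t) :
    (s : Finset V) ⊆ t ∨ (t : Finset V) ⊆ s := by
  by_contra! h
  obtain ⟨⟨v, hvs, hvt⟩, ⟨w, hwt, hws⟩⟩ :=
    And.intro (Finset.not_subset.1 h.1) (Finset.not_subset.1 h.2)
  exact lt_asymm ((hs v hvs).2 w hws) ((ht w hwt).2 v hvt)

variable {G : Type*} [Group G] [MulAction G V] [IsSimplicialAction G X]

theorem smul_coord (g : G) (x : X.Realization) (v : V) : (g • x).coord v = x.coord (g⁻¹ • v) :=
  rfl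

theorem continuous_smul_realization (g : G) : Continuous fun x : X.Realization => g • x := by
  refine Realization.continuous_of_comp_ofSimplex fun s => ?_
  let t : X.faces := ⟨_, IsSimplicialAction.map_mem g _ s.2⟩
  let e : {v // v ∈ (t : Finset V)} → {v // v ∈ (s : Finset V)} := fun v => ⟨g⁻¹ • (v : V), by
    obtain ⟨w, hw, h⟩ := Finset.mem_map.1 v.2
    rw [← h]
    simpa using hw⟩
  have he : Function.Bijective e := by
    refine ⟨fun v w h => Subtype.ext (smul_left_cancel g⁻¹ (congrArg Subtype.val h)),
      fun w => ⟨⟨g • (w : V), Finset.mem_map.2 ⟨w, w.2, rfl⟩⟩, Subtype.ext (by simp [e])⟩⟩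
  let f : stdSimplex ℝ (s : Finset V) → stdSimplex ℝ (t : Finset V) := fun p =>
    ⟨fun v => p.1 (e v), fun v => p.2.1 _, by
      rw [← p.2.2]
      exact (Equiv.ofBijective e he).sum_comp p.1⟩
  have hf : Continuous f := by
    refine Continuous.subtype_mk (continuous_pi fun v => ?_) _
    exact (continuous_apply _).comp continuous_subtype_val
  have : (fun x : X.Realization => g • x) ∘ Realization.ofSimplex X s =
      Realization.ofSimplex X t ∘ f := by
    funext p
    refine Realization.ext (Finsupp.ext fun v => ?_)
    simp only [Function.comp_apply, smul_coord]
    by_cases hv : v ∈ (t : Finset V)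
    · rw [Realization.ofSimplex_coord_mem t _ hv, Realization.ofSimplex_coord_mem s _ (e ⟨v, hv⟩).2]
    · rw [Realization.ofSimplex_coord_notMem t _ hv, Realization.ofSimplex_coord_notMem]
      exact fun h => hv (Finset.mem_map.2 ⟨_, h, by simp⟩)
  rw [this]
  exact (Realization.continuous_ofSimplex t).comp hf

/-- The action on the set of simplices. -/
instance : MulAction G X.faces where
  smul g s := ⟨_, IsSimplicialAction.map_mem g _ s.2⟩
  one_smul s := Subtype.ext (by
    ext v
    change v ∈ Finset.map _ _ ↔ _
    simp)
  mul_smul g h s := Subtype.ext (by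
    ext v
    change v ∈ Finset.map _ _ ↔ v ∈ Finset.map _ (Finset.map _ _)
    simp [mul_smul])

theorem coe_smul_face (g : G) (s : X.faces) :
    ((g • s : X.faces) : Finset V) = (s : Finset V).map (MulAction.toPerm g).toEmbedding :=
  rfl

theorem mem_smul_face {g : G} {s : X.faces} {v : V} :
    v ∈ ((g • s : X.faces) : Finset V) ↔ g⁻¹ • v ∈ (s : Finset V) := by
  rw [coe_smul_face, Finset.mem_map]
  exact ⟨fun ⟨w, hw, h⟩ => by rw [← h]; simpa using hw, fun h => ⟨_, h, by simp⟩⟩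

theorem smul_mem_baryStar (g : G) {s : X.faces} {x : X.Realization} (hx : x ∈ X.baryStar s) :
    g • x ∈ X.baryStar (g • s) := by
  intro v hv
  rw [mem_smul_face] at hv
  refine ⟨(hx _ hv).1, fun w hw => (hx _ hv).2 _ ?_⟩
  rwa [mem_smul_face] at hw

/-- Comparable simplices with the same number of vertices coincide. -/
theorem smul_face_eq_of_mem_baryStar {g : G} {s : X.faces} {x : X.Realization}
    (hx : x ∈ X.baryStar s) (hgx : x ∈ X.baryStar (g • s)) : g • s = s := by
  have hc : ((g • s : X.faces) : Finset V).card = (s : Finset V).card := by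
    rw [coe_smul_face, Finset.card_map]
  rcases subset_or_subset_of_mem_baryStar hx hgx with h | h
  · exact Subtype.ext (Finset.eq_of_subset_of_card_le h hc.le).symm
  · exact Subtype.ext (Finset.eq_of_subset_of_card_le h hc.ge)

end AbstractSimplicialComplex

/-! ### Labelled subdivisions of paths -/

section Labelling

variable {ι Z : Type*}

/-- The sets `U (L 0), …, U (L (n - 1))` contain the images under `p` of the `n` consecutive
subintervals of length `1 / n` of the unit interval. -/
def IsLabelling (U : ι → Set Z) (n : ℕ) (L : ℕ → ι) (p : unitInterval → Z) : Prop :=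
  ∀ k < n, ∀ t : unitInterval, (k : ℝ) ≤ n * t → n * (t : ℝ) ≤ k + 1 → p t ∈ U (L k)

/-- The point `k / n` of the unit interval. -/
noncomputable def node (n k : ℕ) : unitInterval :=
  Set.projIcc 0 1 zero_le_one ((k : ℝ) / n)

theorem mul_node {n k : ℕ} (hn : 0 < n) (hk : k ≤ n) : n * (node n k : ℝ) = k := by
  have hn' : (0 : ℝ) < n := by exact_mod_cast hn
  have hk' : (k : ℝ) ≤ n := by exact_mod_cast hk
  rw [node, Set.projIcc_of_mem zero_le_one ⟨by positivity, (div_le_one hn').2 hk'⟩]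
  field_simp

theorem node_mul {n m : ℕ} (hm : 0 < m) (k : ℕ) : node (n * m) (k * m) = node n k := by
  have hm' : (m : ℝ) ≠ 0 := by exact_mod_cast hm.ne'
  rw [node, node]
  push_cast
  rw [mul_div_mul_right _ _ hm']

variable {U : ι → Set Z} {n m : ℕ} {L L' : ℕ → ι} {p : unitInterval → Z}

theorem IsLabelling.mem_left (h : IsLabelling U n L p) {k : ℕ} (hk : k < n) :
    p (node n k) ∈ U (L k) := by
  have := mul_node (Nat.zero_lt_of_lt hk) hk.le
  exact h k hk _ this.ge (by linarith)

theorem IsLabelling.mem_right (h : IsLabelling U n L p) {k : ℕ} (hk : k < n) :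
    p (node n (k + 1)) ∈ U (L k) := by
  have := mul_node (Nat.zero_lt_of_lt hk) (Nat.succ_le_of_lt hk)
  push_cast at this
  exact h k hk _ (by linarith) this.le

/-- At the left end point of an interval, the labels of that interval and of the preceding one
are both valid. -/
theorem IsLabelling.mem_pred (h : IsLabelling U n L p) {k : ℕ} (hk : k < n) :
    p (node n k) ∈ U (L (k - 1)) := by
  rcases k with _ | k
  · exact h.mem_left hk
  · exact h.mem_right (k := k) (by omega)

theorem IsLabelling.refine (h : IsLabelling U n L p) (hm : 0 < m) :
    IsLabelling U (n * m) (fun k => L (k / m)) p := by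
  intro k hk t h1 h2
  have hpos : (0 : ℝ) < m := by exact_mod_cast hm
  have h3 : ((k / m : ℕ) : ℝ) * m ≤ k := by exact_mod_cast Nat.div_mul_le_self k m
  have h4 : (k : ℝ) + 1 ≤ ((k / m : ℕ) + 1) * m := by
    exact_mod_cast Nat.succ_le_of_lt (Nat.lt_mul_of_div_lt (Nat.lt_succ_self (k / m)) hm)
  push_cast at h1 h2
  refine h (k / m) (Nat.div_lt_of_lt_mul (by linarith)) t ?_ ?_
  · exact le_of_mul_le_mul_right (by linarith) hpos
  · exact le_of_mul_le_mul_right (by linarith) hpos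

/-- A function that is locally constant on an intersection of sets `U i` is constant along every
interval of a labelled subdivision by these sets. -/
theorem IsLabelling.eq_of_locally_constant [TopologicalSpace Z] {A : Type*} {f : Z → A}
    (hp : Continuous p) {k : ℕ} (hk : k < n)
    (hf : ∀ t : unitInterval, (k : ℝ) ≤ n * t → n * (t : ℝ) ≤ k + 1 →
      ∀ᶠ z in 𝓝 (p t), f z = f (p t)) :
    f (p (node n (k + 1))) = f (p (node n k)) := by
  let _ : TopologicalSpace A := ⊥
  have : DiscreteTopology A := ⟨rfl⟩
  have hn : 0 < n := Nat.zero_lt_of_lt hk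
  let s : Set unitInterval := {t | (k : ℝ) ≤ n * t ∧ n * (t : ℝ) ≤ k + 1}
  have hs : s.OrdConnected := ⟨fun x hx y hy z hz => by
    have h1 : (x : ℝ) ≤ z := hz.1
    have h2 : (z : ℝ) ≤ y := hz.2
    have hn' : (0 : ℝ) ≤ n := by positivity
    exact ⟨hx.1.trans (by gcongr), le_trans (by gcongr) hy.2⟩⟩
  refine hs.isPreconnected.constant (f := f ∘ p) (fun t ht => ?_) ?_ ?_
  · refine ContinuousAt.continuousWithinAt ?_
    refine continuousAt_const.congr (f := fun _ => f (p t)) ?_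
    filter_upwards [hp.continuousAt.eventually (hf t ht.1 ht.2)] with t' h' using h'.symm
  · have := mul_node hn (Nat.succ_le_of_lt hk)
    push_cast at this
    exact ⟨by linarith, this.le⟩
  · have := mul_node hn hk.le
    exact ⟨this.ge, by linarith⟩

theorem isOpen_setOf_isLabelling [TopologicalSpace Z] (hU : ∀ i, IsOpen (U i)) (x y : Z) (n : ℕ)
    (L : ℕ → ι) : IsOpen {p : Path x y | IsLabelling U n L p} := by
  have : {p : Path x y | IsLabelling U n L p} = ⋂ k ∈ Finset.range n,
      (fun p : Path x y => (p : C(unitInterval, Z))) ⁻¹'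
        {p | Set.MapsTo p {t : unitInterval | (k : ℝ) ≤ n * t ∧ n * (t : ℝ) ≤ k + 1}
          (U (L k))} := by
    ext p
    simp only [IsLabelling, Set.mem_iInter, Finset.mem_range, Set.MapsTo, Set.mem_preimage,
      Set.mem_ofPred_eq, and_imp]
    rfl
  rw [this]
  refine isOpen_biInter_finset fun k _ => IsOpen.preimage continuous_induced_dom
    (ContinuousMap.isOpen_setOfPred_mapsTo (IsClosed.isCompact ?_) (hU _))
  have hc : Continuous fun t : unitInterval => (n : ℝ) * t := by fun_prop
  exact (isClosed_le continuous_const hc).inter (isClosed_le hc continuous_const)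

/-- Every sufficiently fine subdivision of a path has a labelling by the sets of an open cover
with given first and last label. -/
theorem exists_isLabelling [TopologicalSpace Z] (hU : ∀ i, IsOpen (U i))
    (hcov : ∀ z, ∃ i, z ∈ U i) {x y : Z} (p : Path x y) {i j : ι} (hi : x ∈ U i) (hj : y ∈ U j) :
    ∃ N : ℕ, ∀ n ≥ N, ∃ L : ℕ → ι, L 0 = i ∧ L (n - 1) = j ∧ IsLabelling U n L p := by
  obtain ⟨δ, hδ, hball⟩ := lebesgue_number_lemma_of_metric (s := (Set.univ : Set unitInterval))
    isCompact_univ (c := fun i => p ⁻¹' U i) (fun i => (hU i).preimage p.continuous)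
    (fun t _ => Set.mem_iUnion.2 (hcov (p t)))
  obtain ⟨δ₀, hδ₀, h₀⟩ := Metric.isOpen_iff.1 ((hU i).preimage p.continuous) 0 (by simpa using hi)
  obtain ⟨δ₁, hδ₁, h₁⟩ := Metric.isOpen_iff.1 ((hU j).preimage p.continuous) 1 (by simpa using hj)
  choose f hf using fun t => hball t (Set.mem_univ t)
  obtain ⟨N, hN⟩ := exists_nat_gt (1 / min δ (min δ₀ δ₁))
  -- At least two pieces are needed so that the prescribed first and last labels do not compete for
  -- the same piece.
  refine ⟨max N 2, fun n hn => ⟨fun k => if k = 0 then i else if k = n - 1 then j else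
    f (node n k), by simp, ?_, ?_⟩⟩
  · have : n - 1 ≠ 0 := by have := le_of_max_le_right hn; omega
    simp [this]
  intro k hk t h1 h2
  have hn0 : 0 < n := Nat.zero_lt_of_lt hk
  have hn' : (0 : ℝ) < n := by exact_mod_cast hn0
  have hpos : 0 < min δ (min δ₀ δ₁) := lt_min hδ (lt_min hδ₀ hδ₁)
  have hsmall : 1 < n * min δ (min δ₀ δ₁) := by
    rw [div_lt_iff₀ hpos] at hN
    refine hN.trans_le ?_
    gcongr
    exact le_of_max_le_left hn
  have key : ∀ {a b : unitInterval} {ε : ℝ}, min δ (min δ₀ δ₁) ≤ ε →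
      |n * (a : ℝ) - n * b| ≤ 1 → a ∈ Metric.ball b ε := by
    intro a b ε hε h
    rw [Metric.mem_ball, Subtype.dist_eq, Real.dist_eq]
    rw [← mul_sub, abs_mul, abs_of_pos hn'] at h
    have : n * |(a : ℝ) - b| < n * ε := by
      calc _ ≤ 1 := h
        _ < n * min δ (min δ₀ δ₁) := hsmall
        _ ≤ n * ε := by gcongr
    exact lt_of_mul_lt_mul_left this hn'.le
  dsimp only
  split_ifs with hk0 hk1
  · refine h₀ (key ((min_le_right _ _).trans (min_le_left _ _)) ?_)
    subst hk0
    rw [abs_le]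
    push_cast at *
    constructor <;> linarith
  · refine h₁ (key ((min_le_right _ _).trans (min_le_right _ _)) ?_)
    have hk' : (k : ℝ) = n - 1 := by
      rw [hk1, Nat.cast_sub (by omega)]
      simp
    rw [abs_le]
    push_cast at *
    constructor <;> linarith
  · refine hf _ (key (min_le_left _ _) ?_)
    rw [mul_node hn0 hk.le, abs_le]
    constructor <;> linarith

/-- Labellings of two consecutive paths give one of their concatenation. -/
theorem IsLabelling.trans [TopologicalSpace Z] {x y z : Z} {p : Path x y} {q : Path y z}
    (hp : IsLabelling U n L p) (hq : IsLabelling U n L' q) :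
    IsLabelling U (n + n) (fun k => if k < n then L k else L' (k - n)) (p.trans q) := by
  intro k hk t h1 h2
  have hn' : (0 : ℝ) < n := by exact_mod_cast (show 0 < n by omega)
  push_cast at h1 h2
  rw [Path.trans_apply]
  by_cases hkn : k < n
  · have hkn' : (k : ℝ) + 1 ≤ n := by exact_mod_cast hkn
    have ht : (t : ℝ) ≤ 1 / 2 := by
      have : n * (t : ℝ) ≤ n * (1 / 2) := by linarith
      exact le_of_mul_le_mul_left this hn'
    rw [dif_pos ht]
    simp only [hkn, if_true]
    refine hp k hkn _ ?_ ?_ <;> dsimp only <;> linarith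
  · have hkn' : (n : ℝ) ≤ k := by exact_mod_cast not_lt.1 hkn
    have hc : ((k - n : ℕ) : ℝ) = k - n := by rw [Nat.cast_sub (not_lt.1 hkn)]
    simp only [hkn, if_false]
    -- The midpoint also belongs to the first piece of `q`, although `Path.trans` evaluates it
    -- through `p`.
    by_cases ht : (t : ℝ) ≤ 1 / 2
    · rw [dif_pos ht]
      have h3 : (t : ℝ) = 1 / 2 := by
        refine le_antisymm ht (le_of_mul_le_mul_left ?_ hn')
        linarith
      have h4 : k = n := by
        have : (k : ℝ) ≤ n := by rw [h3] at h1; linarith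
        exact le_antisymm (by exact_mod_cast this) (not_lt.1 hkn)
      have h5 := hq 0 (by omega) 0 (by simp) (by simp)
      have h6 : (⟨2 * (t : ℝ), (unitInterval.mul_pos_mem_iff zero_lt_two).2 ⟨t.2.1, ht⟩⟩ :
          unitInterval) = 1 := Subtype.ext (by change 2 * (t : ℝ) = 1; linarith)
      rw [h6, p.target, h4, Nat.sub_self]
      simpa using h5
    · rw [dif_neg ht]
      refine hq (k - n) (by omega) _ ?_ ?_ <;> dsimp only <;> rw [hc] <;> linarith

end Labelling

/-! ### Transgression of 2-cocycles to the loop space -/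

section LoopTrivialization

variable {ι Y A : Type*} [AddCommGroup A]

/-- The coboundary of a `1`-cochain with values in `A`. -/
def coboundary (τ : ι → ι → A) (i j k : ι) : A :=
  τ i j + τ j k - τ i k

/-- The contribution of a point to the difference between two labellings `L`, `M` of a loop, where
`L` changes from `i'` to `i` and `M` changes from `j'` to `j`. -/
def nodeTerm (τ : ι → ι → A) (i' i j' j : ι) : A :=
  coboundary τ i' i j - coboundary τ i' j' j

/-- The definition by coboundaries makes local constancy visible; this form separates the jumps of
the two labellings from a difference that telescopes when `τ` does not vary. -/
theorem nodeTerm_eq (τ : ι → ι → A) (i' i j' j : ι) :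
    nodeTerm τ i' i j' j = τ i' i - τ j' j + (τ i j - τ i' j') := by
  simp only [nodeTerm, coboundary]
  abel

/-- The difference between two labellings `L`, `M` of a path `p` subdivided into `n` pieces:
the transgression of the coboundaries of the `1`-cochains `τ y`. -/
noncomputable def nodeSum (τ : Y → ι → ι → A) (n : ℕ) (L M : ℕ → ι) (p : unitInterval → Y) : A :=
  ∑ k ∈ Finset.range n, nodeTerm (τ (p (node n k))) (L (k - 1)) (L k) (M (k - 1)) (M k)

theorem Finset.sum_range_mul_of_eq_zero {m : ℕ} (hm : 0 < m) (n : ℕ) (f g : ℕ → A)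
    (h : ∀ k, f (k * m) = g k) (h0 : ∀ k r, 0 < r → r < m → f (k * m + r) = 0) :
    ∑ k ∈ Finset.range (n * m), f k = ∑ k ∈ Finset.range n, g k := by
  induction n with
  | zero => simp
  | succ n ih =>
    rw [Nat.succ_mul, Finset.sum_range_add, ih, Finset.sum_range_succ, ← h]
    congr 1
    rw [Finset.sum_eq_single_of_mem 0 (Finset.mem_range.2 hm), add_zero]
    exact fun r hr hr0 => h0 n r (Nat.pos_of_ne_zero hr0) (Finset.mem_range.1 hr)

/-- The fine piece before a coarse node lies in the preceding coarse piece. Truncated subtraction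
makes this true at `k = 0` too. -/
theorem Nat.mul_sub_one_div {m : ℕ} (hm : 0 < m) (k : ℕ) : (k * m - 1) / m = k - 1 := by
  rcases k with _ | k
  · simp
  · rw [Nat.succ_mul, Nat.add_sub_assoc hm, mul_comm, Nat.mul_add_div hm,
      Nat.div_eq_of_lt (by omega)]
    rfl

theorem Nat.mul_add_div_eq {m r : ℕ} (k : ℕ) (hr : r < m) : (k * m + r) / m = k := by
  rw [mul_comm, Nat.mul_add_div (by omega), Nat.div_eq_of_lt hr, add_zero]

variable {τ : Y → ι → ι → A}

/-- No label changes at a new node, so its term vanishes; old nodes keep their terms. -/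
theorem nodeSum_refine (hτ : ∀ y i, τ y i i = 0) {m : ℕ} (hm : 0 < m) (n : ℕ) (L M : ℕ → ι)
    (p : unitInterval → Y) :
    nodeSum τ (n * m) (fun k => L (k / m)) (fun k => M (k / m)) p = nodeSum τ n L M p := by
  refine Finset.sum_range_mul_of_eq_zero hm n _ _ (fun k => ?_) fun k r h0 hr => ?_
  · dsimp only
    rw [node_mul hm, Nat.mul_sub_one_div hm, Nat.mul_div_cancel _ hm]
  · have h1 : (k * m + r - 1) / m = k := by
      rw [Nat.add_sub_assoc h0, Nat.mul_add_div_eq k (by omega)]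
    dsimp only
    rw [h1, Nat.mul_add_div_eq k hr, nodeTerm_eq]
    simp [hτ]

variable {U : ι → Set Y}

/-- The defect of additivity at a node is the change there of the coboundary on the three labels.
Between nodes this coboundary is constant, so the defects telescope to end terms, which vanish
because the labels agree. -/
theorem nodeSum_add [TopologicalSpace Y] (hτ : ∀ y i, τ y i i = 0)
    (hloc : ∀ i j k y, y ∈ U i → y ∈ U j → y ∈ U k →
      ∀ᶠ y' in 𝓝 y, coboundary (τ y') i j k = coboundary (τ y) i j k)
    {n : ℕ} (hn : 0 < n) {I J L : ℕ → ι} {p : unitInterval → Y} (hp : Continuous p)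
    (hI : IsLabelling U n I p) (hJ : IsLabelling U n J p) (hL : IsLabelling U n L p)
    (hIJ : I 0 = J 0) (hJL : J 0 = L 0) (hIJ' : I (n - 1) = J (n - 1))
    (hJL' : J (n - 1) = L (n - 1)) :
    nodeSum τ n I J p + nodeSum τ n J L p = nodeSum τ n I L p := by
  obtain ⟨n, rfl⟩ := Nat.exists_eq_succ_of_ne_zero hn.ne'
  simp only [Nat.succ_eq_add_one, Nat.add_sub_cancel] at *
  -- The point and the labels are indexed separately: `c k k` and `c (k + 1) k` are the values at
  -- the two ends of piece `k`.
  set c : ℕ → ℕ → A := fun k l => coboundary (τ (p (node (n + 1) k))) (I l) (J l) (L l) with hc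
  have hconst : ∀ k < n, c (k + 1) k = c k k := fun k hk =>
    IsLabelling.eq_of_locally_constant (f := fun y => coboundary (τ y) (I k) (J k) (L k)) hp
      (by omega) fun t h1 h2 => hloc _ _ _ _ (hI k (by omega) t h1 h2) (hJ k (by omega) t h1 h2)
        (hL k (by omega) t h1 h2)
  have hterm : ∀ k, nodeTerm (τ (p (node (n + 1) k))) (I (k - 1)) (I k) (J (k - 1)) (J k) +
      nodeTerm (τ (p (node (n + 1) k))) (J (k - 1)) (J k) (L (k - 1)) (L k) -
      nodeTerm (τ (p (node (n + 1) k))) (I (k - 1)) (I k) (L (k - 1)) (L k) =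
      c k k - c k (k - 1) := fun k => by
    simp only [nodeTerm_eq, hc, coboundary]
    abel
  have hsum : nodeSum τ (n + 1) I J p + nodeSum τ (n + 1) J L p - nodeSum τ (n + 1) I L p =
      ∑ k ∈ Finset.range (n + 1), (c k k - c k (k - 1)) := by
    simp only [nodeSum, ← Finset.sum_add_distrib, ← Finset.sum_sub_distrib]
    exact Finset.sum_congr rfl fun k _ => hterm k
  have hzero : ∑ k ∈ Finset.range (n + 1), (c k k - c k (k - 1)) = 0 := by
    rw [Finset.sum_range_succ']
    have : ∑ k ∈ Finset.range n, (c (k + 1) (k + 1) - c (k + 1) (k + 1 - 1)) =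
        ∑ k ∈ Finset.range n, (c (k + 1) (k + 1) - c k k) :=
      Finset.sum_congr rfl fun k hk => by
        rw [Nat.add_sub_cancel, hconst k (Finset.mem_range.1 hk)]
    rw [this, Finset.sum_range_sub (fun k => c k k)]
    simp [hc, coboundary, ← hJL, ← hIJ, ← hJL', ← hIJ', hτ]
  rw [hzero, sub_eq_zero] at hsum
  exact hsum

/-- A labelling of a loop whose first and last label is `i₀`. -/
structure IsLoopLabelling (U : ι → Set Y) (i₀ : ι) (n : ℕ) (L : ℕ → ι)
    (p : unitInterval → Y) : Prop where
  pos : 0 < n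
  first : L 0 = i₀
  last : L (n - 1) = i₀
  isLabelling : IsLabelling U n L p

theorem IsLoopLabelling.refine {i₀ : ι} {n m : ℕ} {L : ℕ → ι} {p : unitInterval → Y}
    (h : IsLoopLabelling U i₀ n L p) (hm : 0 < m) :
    IsLoopLabelling U i₀ (n * m) (fun k => L (k / m)) p where
  pos := Nat.mul_pos h.pos hm
  first := by simpa using h.first
  last := by rw [Nat.mul_sub_one_div hm, h.last]
  isLabelling := h.isLabelling.refine hm

/-- The difference between two labellings of a loop with different numbers of pieces. -/
noncomputable def labelDiff (τ : Y → ι → ι → A) (a b : ℕ × (ℕ → ι)) (p : unitInterval → Y) : A :=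
  nodeSum τ (a.1 * b.1) (fun k => a.2 (k / b.1)) (fun k => b.2 (k / a.1)) p

/-- Any further common refinement computes the same difference, so that three labellings can be
compared on one subdivision. -/
theorem labelDiff_eq (hτ : ∀ y i, τ y i i = 0) {a b : ℕ × (ℕ → ι)} {N r s l : ℕ} (hl : 0 < l)
    (hN : N = a.1 * b.1 * l) (hr : r = b.1 * l) (hs : s = a.1 * l) (p : unitInterval → Y) :
    labelDiff τ a b p = nodeSum τ N (fun k => a.2 (k / r)) (fun k => b.2 (k / s)) p := by
  subst hN hr hs
  rw [labelDiff, ← nodeSum_refine hτ hl]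
  simp only [Nat.div_div_eq_div_mul, mul_comm l]

/-- On a `2`-connected space, the transgression of a locally constant Čech `2`-cocycle to the loop
space is trivial. -/
theorem exists_loop_trivialization [TopologicalSpace Y] (hY : IsTwoConnected Y)
    (hU : ∀ i, IsOpen (U i))
    (hcov : ∀ y, ∃ i, y ∈ U i) (hτ : ∀ y i, τ y i i = 0)
    (hloc : ∀ i j k y, y ∈ U i → y ∈ U j → y ∈ U k →
      ∀ᶠ y' in 𝓝 y, coboundary (τ y') i j k = coboundary (τ y) i j k)
    {y₀ : Y} {i₀ : ι} (h₀ : y₀ ∈ U i₀) :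
    ∃ h : ℕ × (ℕ → ι) → Path y₀ y₀ → A,
      (∀ a b (p : Path y₀ y₀), IsLoopLabelling U i₀ a.1 a.2 p → IsLoopLabelling U i₀ b.1 b.2 p →
        h a p + labelDiff τ a b p = h b p) ∧
      ∀ (ω : C(unitInterval, Path y₀ y₀)) a t, IsLoopLabelling U i₀ a.1 a.2 (ω t) →
        ∀ᶠ t' in 𝓝 t, h a (ω t') = h a (ω t) := by
  have := hY.simplyConnectedSpace_path y₀
  let 𝒰 : ℕ × (ℕ → ι) → Set (Path y₀ y₀) := fun a => {p | IsLoopLabelling U i₀ a.1 a.2 p}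
  have h𝒰 : ∀ a, IsOpen (𝒰 a) := fun a => by
    by_cases ha : 0 < a.1 ∧ a.2 0 = i₀ ∧ a.2 (a.1 - 1) = i₀
    · have : 𝒰 a = {p : Path y₀ y₀ | IsLabelling U a.1 a.2 p} :=
        Set.ext fun p => ⟨fun h => h.isLabelling, fun h => ⟨ha.1, ha.2.1, ha.2.2, h⟩⟩
      rw [this]
      exact isOpen_setOf_isLabelling hU _ _ _ _
    · have : 𝒰 a = ∅ := Set.eq_empty_of_forall_notMem fun p h => ha ⟨h.pos, h.first, h.last⟩
      rw [this]
      exact isOpen_empty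
  have hcov' : ∀ p, ∃ a, p ∈ 𝒰 a := fun p => by
    obtain ⟨N, hN⟩ := exists_isLabelling hU hcov p h₀ h₀
    obtain ⟨L, h1, h2, h3⟩ := hN (N + 1) (by omega)
    exact ⟨(N + 1, L), by simp, h1, h2, h3⟩
  have hloc' : ∀ a b p, p ∈ 𝒰 a → p ∈ 𝒰 b →
      ∀ᶠ p' : Path y₀ y₀ in 𝓝 p, labelDiff τ a b p' = labelDiff τ a b p := by
    intro a b p ha hb
    have ha' := ha.refine hb.pos
    have hb' := hb.refine ha.pos
    rw [mul_comm] at hb'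
    have hterm : ∀ k ∈ Finset.range (a.1 * b.1), ∀ᶠ p' : Path y₀ y₀ in 𝓝 p,
        nodeTerm (τ (p' (node (a.1 * b.1) k))) (a.2 ((k - 1) / b.1)) (a.2 (k / b.1))
          (b.2 ((k - 1) / a.1)) (b.2 (k / a.1)) =
        nodeTerm (τ (p (node (a.1 * b.1) k))) (a.2 ((k - 1) / b.1)) (a.2 (k / b.1))
          (b.2 ((k - 1) / a.1)) (b.2 (k / a.1)) := by
      intro k hk
      rw [Finset.mem_range] at hk
      have hev : Continuous fun p' : Path y₀ y₀ => p' (node (a.1 * b.1) k) := by fun_prop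
      have e1 := hev.continuousAt.eventually (hloc _ _ _ _ (ha'.isLabelling.mem_pred hk)
        (ha'.isLabelling.mem_left hk) (hb'.isLabelling.mem_left hk))
      have e2 := hev.continuousAt.eventually (hloc _ _ _ _ (ha'.isLabelling.mem_pred hk)
        (hb'.isLabelling.mem_pred hk) (hb'.isLabelling.mem_left hk))
      filter_upwards [e1, e2] with p' h1 h2
      rw [nodeTerm, nodeTerm, h1, h2]
    filter_upwards [(Finset.range (a.1 * b.1)).eventually_all.2 hterm] with p' h'
    exact Finset.sum_congr rfl h'
  have hadd : ∀ a b c p, p ∈ 𝒰 a → p ∈ 𝒰 b → p ∈ 𝒰 c →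
      labelDiff τ a b p + labelDiff τ b c p = labelDiff τ a c p := by
    intro a b c p ha hb hc
    have ha' := ha.refine (Nat.mul_pos hb.pos hc.pos)
    have hb' := hb.refine (Nat.mul_pos ha.pos hc.pos)
    have hc' := hc.refine (Nat.mul_pos ha.pos hb.pos)
    rw [← mul_assoc] at ha'
    rw [show b.1 * (a.1 * c.1) = a.1 * b.1 * c.1 by ring] at hb'
    rw [show c.1 * (a.1 * b.1) = a.1 * b.1 * c.1 by ring] at hc'
    rw [labelDiff_eq hτ (a := a) (b := b) hc.pos rfl rfl rfl,
      labelDiff_eq hτ (a := b) (b := c) (N := a.1 * b.1 * c.1) ha.pos (by ring)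
        (mul_comm a.1 c.1) (mul_comm a.1 b.1),
      labelDiff_eq hτ (a := a) (b := c) (N := a.1 * b.1 * c.1) hb.pos (by ring)
        (mul_comm b.1 c.1) rfl]
    exact nodeSum_add hτ hloc ha'.pos p.continuous ha'.isLabelling hb'.isLabelling hc'.isLabelling
      (ha'.first.trans hb'.first.symm) (hb'.first.trans hc'.first.symm)
      (ha'.last.trans hb'.last.symm) (hb'.last.trans hc'.last.symm)
  obtain ⟨b, hb, hb'⟩ := exists_cech_trivialization 𝒰 h𝒰 hcov'
    (fun a b p => Multiplicative.ofAdd (labelDiff τ a b p))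
    (fun a b p ha hb => (hloc' a b p ha hb).mono fun p' h => congrArg Multiplicative.ofAdd h)
    (fun a b c p ha hb hc => congrArg Multiplicative.ofAdd (hadd a b c p ha hb hc))
  exact ⟨fun a p => (b a p).toAdd,
    fun a c p ha hc => congrArg Multiplicative.toAdd (hb a c p ha hc),
    fun ω a t ht => (hb' ω a t ht).mono fun t' h => congrArg Multiplicative.toAdd h⟩

end LoopTrivialization

/-! ### Slice covers of a space with a group action -/

section SliceCover

variable {G X S : Type*} [Group G] [TopologicalSpace X] [MulAction G X] [MulAction G S]

/-- The projection to the set of orbits. -/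
abbrev toOrbit (G : Type*) {T : Type*} [Group G] [MulAction G T] (x : T) :
    MulAction.orbitRel.Quotient G T :=
  Quotient.mk (MulAction.orbitRel G T) x

theorem toOrbit_eq_iff {T : Type*} [MulAction G T] {x y : T} :
    toOrbit G x = toOrbit G y ↔ ∃ g : G, g • y = x :=
  Quotient.eq.trans Iff.rfl

theorem toOrbit_smul {T : Type*} [MulAction G T] (g : G) (x : T) :
    toOrbit G (g • x) = toOrbit G x :=
  toOrbit_eq_iff.2 ⟨g, rfl⟩

/-- An equivariant open cover of `X`, indexed by a `G`-set `S`, whose members are either equal to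
or disjoint from their translates. -/
structure IsSliceCover (G : Type*) {X S : Type*} [Group G] [TopologicalSpace X] [MulAction G X]
    [MulAction G S] (W : S → Set X) : Prop where
  isOpen : ∀ s, IsOpen (W s)
  exists_mem : ∀ x, ∃ s, x ∈ W s
  smul_mem : ∀ (g : G) {s x}, x ∈ W s → g • x ∈ W (g • s)
  smul_eq : ∀ {g : G} {s x}, x ∈ W s → x ∈ W (g • s) → g • s = s

/-- The image in the orbit space of the members of a slice cover with index in a given orbit. -/
def orbitCover (G : Type*) {X S : Type*} [Group G] [MulAction G X] [MulAction G S] (W : S → Set X)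
    (σ : MulAction.orbitRel.Quotient G S) : Set (MulAction.orbitRel.Quotient G X) :=
  {y | ∃ x s, toOrbit G x = y ∧ toOrbit G s = σ ∧ x ∈ W s}

theorem mem_orbitCover {G X S : Type*} [Group G] [MulAction G X] [MulAction G S] {W : S → Set X}
    {s : S} {x : X} (hx : x ∈ W s) : toOrbit G x ∈ orbitCover G W (toOrbit G s) :=
  ⟨x, s, rfl, rfl, hx⟩

/-- The orbit projection is open, so local statements can be checked upstairs. -/
theorem eventually_toOrbit [ContinuousConstSMul G X] {x : X} {N : Set X} (hN : N ∈ 𝓝 x)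
    {P : MulAction.orbitRel.Quotient G X → Prop} (h : ∀ x' ∈ N, P (toOrbit G x')) :
    ∀ᶠ y in 𝓝 (toOrbit G x), P y := by
  have hopen : IsOpenMap (toOrbit G : X → _) := isOpenMap_quotient_mk'_mul
  filter_upwards [hopen.image_mem_nhds hN]
  rintro _ ⟨x', hx', rfl⟩
  exact h x' hx'

open Classical in
/-- The index in the orbit `σ` of a member of the slice cover that contains the chosen
representative of the orbit `y`. -/
noncomputable def sliceIndex (W : S → Set X) (y : MulAction.orbitRel.Quotient G X)
    (σ : MulAction.orbitRel.Quotient G S) : S :=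
  if h : ∃ s, toOrbit G s = σ ∧ y.out ∈ W s then h.choose else σ.out

namespace IsSliceCover

variable {W : S → Set X}

theorem exists_of_mem_orbitCover (hW : IsSliceCover G W)
    {σ : MulAction.orbitRel.Quotient G S} {x : X} (hx : toOrbit G x ∈ orbitCover G W σ) :
    ∃ s, toOrbit G s = σ ∧ x ∈ W s := by
  obtain ⟨x', s, hx', rfl, hs⟩ := hx
  obtain ⟨g, rfl⟩ := toOrbit_eq_iff.1 hx'
  refine ⟨g⁻¹ • s, toOrbit_smul _ _, ?_⟩
  simpa using hW.smul_mem g⁻¹ hs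

/-- Let `g` move `x` to the chosen representative of its orbit; the slice property leaves `g • s` as
the only possible index. Since one `g` serves all `s`, invariant expressions in several indices
descend to the orbit space. -/
theorem exists_sliceIndex_eq (hW : IsSliceCover G W) (x : X) :
    ∃ g : G, ∀ s, x ∈ W s → sliceIndex W (toOrbit G x) (toOrbit G s) = g • s := by
  have hx : toOrbit G (toOrbit G x).out = toOrbit G x := Quotient.out_eq _
  obtain ⟨g, hg⟩ := toOrbit_eq_iff.1 hx
  refine ⟨g, fun s hs => ?_⟩
  have h : ∃ t, toOrbit G t = toOrbit G s ∧ (toOrbit G x).out ∈ W t :=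
    ⟨g • s, toOrbit_smul _ _, hg ▸ hW.smul_mem g hs⟩
  rw [sliceIndex, dif_pos h]
  obtain ⟨h1, h2⟩ := h.choose_spec
  obtain ⟨k, hk⟩ := toOrbit_eq_iff.1 (h1.trans (toOrbit_smul g s).symm)
  rw [← hk] at h2 ⊢
  exact hW.smul_eq (hg ▸ hW.smul_mem g hs) h2

theorem exists_mem_orbitCover (hW : IsSliceCover G W) (y : MulAction.orbitRel.Quotient G X) :
    ∃ σ, y ∈ orbitCover G W σ := by
  induction y using Quotient.inductionOn with | _ x =>
  obtain ⟨s, hs⟩ := hW.exists_mem x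
  exact ⟨_, mem_orbitCover hs⟩

variable [ContinuousConstSMul G X]

theorem isOpen_orbitCover (hW : IsSliceCover G W) (σ : MulAction.orbitRel.Quotient G S) :
    IsOpen (orbitCover G W σ) := by
  refine isOpen_iff_mem_nhds.2 ?_
  rintro _ ⟨x, s, rfl, rfl, hx⟩
  exact eventually_toOrbit ((hW.isOpen s).mem_nhds hx) fun _ h => mem_orbitCover h

/-- If a path connected space has simply connected orbit space, then every homomorphism on the
group that is trivialized over the index set of a slice cover is trivial. -/
theorem map_eq_one (hW : IsSliceCover G W) [PathConnectedSpace X]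
    [SimplyConnectedSpace (MulAction.orbitRel.Quotient G X)] {Q : Type*} [Group Q] (q : G →* Q)
    (f : S → Q) (hf : ∀ (g : G) s, f (g • s) = q g * f s) (g : G) : q g = 1 := by
  have ha : ∀ x s t, x ∈ W s → x ∈ W t →
      (f (sliceIndex W (toOrbit G x) (toOrbit G s)))⁻¹ *
        f (sliceIndex W (toOrbit G x) (toOrbit G t)) = (f s)⁻¹ * f t := by
    intro x s t hs ht
    obtain ⟨k, hk⟩ := hW.exists_sliceIndex_eq x
    rw [hk s hs, hk t ht, hf, hf]
    group
  obtain ⟨b, hb, hb'⟩ := exists_cech_trivialization (orbitCover G W) hW.isOpen_orbitCover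
    hW.exists_mem_orbitCover (fun σ τ y => (f (sliceIndex W y σ))⁻¹ * f (sliceIndex W y τ))
    (fun σ τ y hσ hτ => by
      induction y using Quotient.inductionOn with | _ x =>
      obtain ⟨s, rfl, hs⟩ := hW.exists_of_mem_orbitCover hσ
      obtain ⟨t, rfl, ht⟩ := hW.exists_of_mem_orbitCover hτ
      refine eventually_toOrbit
        (Filter.inter_mem ((hW.isOpen s).mem_nhds hs) ((hW.isOpen t).mem_nhds ht)) ?_
      rintro x' ⟨hs', ht'⟩
      exact (ha x' s t hs' ht').trans (ha x s t hs ht).symm)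
    (fun σ τ ρ y _ _ _ => by group)
  -- The corrected value does not depend on the index, hence defines a function `F` on `X`. It is
  -- constant along paths, while `F (g • x₀) = q g * F x₀`.
  have hF : ∀ x s t, x ∈ W s → x ∈ W t →
      f s * (b (toOrbit G s) (toOrbit G x))⁻¹ = f t * (b (toOrbit G t) (toOrbit G x))⁻¹ := by
    intro x s t hs ht
    rw [← hb _ _ _ (mem_orbitCover hs) (mem_orbitCover ht), ha x s t hs ht]
    group
  choose idx hidx using hW.exists_mem
  set F : X → Q := fun x => f (idx x) * (b (toOrbit G (idx x)) (toOrbit G x))⁻¹ with hFdef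
  obtain ⟨x₀⟩ := (inferInstance : Nonempty X)
  obtain ⟨p⟩ := PathConnectedSpace.joined x₀ (g • x₀)
  have hlc : IsLocallyConstant fun t => F (p t) := by
    refine (IsLocallyConstant.iff_eventually_eq _).2 fun t => ?_
    have h1 := hb' ⟨fun t => toOrbit G (p t), continuous_quotient_mk'.comp p.continuous⟩
      (toOrbit G (idx (p t))) t (mem_orbitCover (hidx _))
    have h2 := p.continuous.continuousAt.eventually ((hW.isOpen (idx (p t))).mem_nhds (hidx (p t)))
    filter_upwards [h1, h2] with t' e1 e2
    simp only [ContinuousMap.coe_mk] at e1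
    rw [hFdef]
    dsimp only
    rw [hF _ _ _ (hidx (p t')) e2, e1]
  have h01 := hlc.apply_eq_of_preconnectedSpace 1 0
  simp only [p.source, p.target, hFdef] at h01
  rw [hF _ _ (g • idx x₀) (hidx _) (hW.smul_mem g (hidx _)), hf, toOrbit_smul, toOrbit_smul,
    mul_assoc, mul_eq_right] at h01
  exact h01

end IsSliceCover

/-! ### The transgressed cocycle along paths upstairs -/

section Jump

variable {ι A : Type*} [AddCommGroup A]

/-- The sum of the values of `τ` at all changes of the label. -/
def jumpSum (τ : ι → ι → A) (n : ℕ) (L : ℕ → ι) : A :=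
  ∑ k ∈ Finset.range n, τ (L (k - 1)) (L k)

theorem sum_range_sub_pred (f : ℕ → A) (n : ℕ) :
    ∑ k ∈ Finset.range n, (f k - f (k - 1)) = f (n - 1) - f 0 := by
  rcases n with _ | n
  · simp
  · rw [Finset.sum_range_succ']
    simpa using Finset.sum_range_sub f n

variable {τ : ι → ι → A}

theorem jumpSum_refine (hτ : ∀ i, τ i i = 0) {m : ℕ} (hm : 0 < m) (n : ℕ) (L : ℕ → ι) :
    jumpSum τ (n * m) (fun k => L (k / m)) = jumpSum τ n L := by
  refine Finset.sum_range_mul_of_eq_zero hm n _ _ (fun k => ?_) fun k r h0 hr => ?_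
  · dsimp only
    rw [Nat.mul_sub_one_div hm, Nat.mul_div_cancel _ hm]
  · have h1 : (k * m + r - 1) / m = k := by
      rw [Nat.add_sub_assoc h0, Nat.mul_add_div_eq k (by omega)]
    dsimp only
    rw [h1, Nat.mul_add_div_eq k hr, hτ]

/-- For a single cochain, as upstairs, the transgressed cocycle is a difference of jump sums; the
remaining terms telescope to the equal end labels. -/
theorem sum_nodeTerm (hτ : ∀ i, τ i i = 0) {n : ℕ} {L M : ℕ → ι} (h0 : L 0 = M 0)
    (h1 : L (n - 1) = M (n - 1)) :
    ∑ k ∈ Finset.range n, nodeTerm τ (L (k - 1)) (L k) (M (k - 1)) (M k) =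
      jumpSum τ n L - jumpSum τ n M := by
  simp only [nodeTerm_eq, Finset.sum_add_distrib, Finset.sum_sub_distrib]
  have := sum_range_sub_pred (fun k => τ (L k) (M k)) n
  rw [Finset.sum_sub_distrib, h0, h1, hτ, hτ, sub_zero] at this
  rw [this, add_zero]
  rfl

theorem jumpSum_concat (hτ : ∀ i, τ i i = 0) {n : ℕ} (hn : 0 < n) {L M : ℕ → ι}
    (h : L (n - 1) = M 0) :
    jumpSum τ (n + n) (fun k => if k < n then L k else M (k - n)) =
      jumpSum τ n L + jumpSum τ n M := by
  rw [jumpSum, Finset.sum_range_add]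
  refine congrArg₂ _ (Finset.sum_congr rfl fun k hk => ?_) (Finset.sum_congr rfl fun k hk => ?_)
  · rw [Finset.mem_range] at hk
    rw [if_pos hk, if_pos (by omega)]
  · rcases k with _ | k
    · rw [if_pos (by omega), if_neg (by omega)]
      simp [h, hτ]
    · rw [if_neg (by omega), if_neg (by omega)]
      congr 2 <;> omega

end Jump

end SliceCover

/-! ### Holonomy along paths to translates of the base point -/

section Holonomy

variable {G X S A : Type*} [Group G] [TopologicalSpace X] [MulAction G X] [MulAction G S]
  [AddCommGroup A]

/-- The loop in the orbit space below a path from `x₀` to a translate of `x₀`. -/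
def orbitLoop {x₀ : X} {g : G} (p : Path x₀ (g • x₀)) : Path (toOrbit G x₀) (toOrbit G x₀) :=
  (p.map (f := toOrbit G) continuous_quotient_mk').cast rfl (toOrbit_smul g x₀).symm

theorem orbitLoop_apply {x₀ : X} {g : G} (p : Path x₀ (g • x₀)) (t : unitInterval) :
    orbitLoop p t = toOrbit G (p t) :=
  rfl

/-- A labelling of a path from `x₀` to `g • x₀` with first label `s₀` and last label `g • s₀`. -/
structure IsTranslateLabelling (W : S → Set X) (s₀ : S) {x₀ : X} {g : G} (n : ℕ) (L : ℕ → S)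
    (p : Path x₀ (g • x₀)) : Prop where
  pos : 0 < n
  first : L 0 = s₀
  last : L (n - 1) = g • s₀
  isLabelling : IsLabelling W n L p

theorem IsTranslateLabelling.isLoopLabelling {W : S → Set X} {s₀ : S} {x₀ : X} {g : G} {n : ℕ}
    {L : ℕ → S} {p : Path x₀ (g • x₀)} (h : IsTranslateLabelling W s₀ n L p) :
    IsLoopLabelling (orbitCover G W) (toOrbit G s₀) n (fun k => toOrbit G (L k))
      (orbitLoop p) where
  pos := h.pos
  first := by rw [h.first]
  last := by rw [h.last, toOrbit_smul]
  isLabelling := fun k hk t h1 h2 => mem_orbitCover (h.isLabelling k hk t h1 h2)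

/-- Let `X` be simply connected with `2`-connected orbit space, with a slice cover indexed by `S`.
Let `ε` be a cocycle on a group `Γ` acting through `G`, with values in the functions on `S`, whose
restriction to the pairs of indices of members of the cover that meet is the coboundary of `τ`.
Then `γ ↦ ε γ s₀` factors through `G`, up to a function that is invariant under the
elements `η` which fix a point `z` of some `W s` and satisfy `ε η s = 0`. -/
theorem IsSliceCover.exists_holonomy {Γ : Type*} [Group Γ] [ContinuousConstSMul G X]
    [SimplyConnectedSpace X] {W : S → Set X} (hW : IsSliceCover G W)
    (hY : IsTwoConnected (MulAction.orbitRel.Quotient G X)) (φ : Γ →* G)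
    (hφ : Function.Surjective φ) (ε : Γ → S → A) (τ : S → S → A) (hτ₀ : ∀ s, τ s s = 0)
    (hε : ∀ γ γ' s, ε (γ * γ') s = ε γ (φ γ' • s) + ε γ' s)
    (hτ : ∀ γ x s t, x ∈ W s → x ∈ W t → τ (φ γ • s) (φ γ • t) = τ s t + (ε γ t - ε γ s)) (s₀ : S)
    (hs₀ : (W s₀).Nonempty) :
    ∃ B : G → A, ∀ γ η s z, z ∈ W s → φ η • z = z → φ η • s = s → ε η s = 0 →
      B (φ (η * γ)) - ε (η * γ) s₀ = B (φ γ) - ε γ s₀ := by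
  obtain ⟨x₀, hx₀⟩ := hs₀
  let τY : MulAction.orbitRel.Quotient G X → MulAction.orbitRel.Quotient G S →
    MulAction.orbitRel.Quotient G S → A := fun y σ ρ => τ (sliceIndex W y σ) (sliceIndex W y ρ)
  -- Translation changes `τ` by the coboundary of `ε γ`, which drops out of the coboundary of `τ`.
  have hinv : ∀ (g : G) x s t u, x ∈ W s → x ∈ W t → x ∈ W u →
      coboundary τ (g • s) (g • t) (g • u) = coboundary τ s t u := by
    intro g x s t u hs ht hu
    obtain ⟨γ, rfl⟩ := hφ g
    rw [coboundary, coboundary, hτ γ x s t hs ht, hτ γ x t u ht hu, hτ γ x s u hs hu]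
    abel
  have hcob : ∀ x s t u, x ∈ W s → x ∈ W t → x ∈ W u →
      coboundary (τY (toOrbit G x)) (toOrbit G s) (toOrbit G t) (toOrbit G u) =
        coboundary τ s t u := by
    intro x s t u hs ht hu
    obtain ⟨g, hg⟩ := hW.exists_sliceIndex_eq x
    rw [← hinv g x s t u hs ht hu, ← hg s hs, ← hg t ht, ← hg u hu]
    rfl
  obtain ⟨h, hh, hh'⟩ := exists_loop_trivialization (τ := τY) hY hW.isOpen_orbitCover
    hW.exists_mem_orbitCover (fun y σ => hτ₀ _)
    (fun σ ρ υ y h1 h2 h3 => by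
      induction y using Quotient.inductionOn with | _ x =>
      obtain ⟨s, rfl, hs⟩ := hW.exists_of_mem_orbitCover h1
      obtain ⟨t, rfl, ht⟩ := hW.exists_of_mem_orbitCover h2
      obtain ⟨u, rfl, hu⟩ := hW.exists_of_mem_orbitCover h3
      refine eventually_toOrbit (Filter.inter_mem ((hW.isOpen s).mem_nhds hs)
        (Filter.inter_mem ((hW.isOpen t).mem_nhds ht) ((hW.isOpen u).mem_nhds hu))) ?_
      rintro x' ⟨hs', ht', hu'⟩
      exact (hcob x' s t u hs' ht' hu').trans (hcob x s t u hs ht hu).symm)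
    (y₀ := toOrbit G x₀) (mem_orbitCover hx₀)
  let val : ℕ → (ℕ → S) → ∀ g : G, Path x₀ (g • x₀) → A := fun n L g p =>
    h (n, fun k => toOrbit G (L k)) (orbitLoop p) + jumpSum τ n L
  have hlabel : ∀ (g : G) (p : Path x₀ (g • x₀)), ∃ n L, IsTranslateLabelling W s₀ n L p := by
    intro g p
    obtain ⟨N, hN⟩ := exists_isLabelling hW.isOpen hW.exists_mem p hx₀ (hW.smul_mem g hx₀)
    obtain ⟨L, h1, h2, h3⟩ := hN (N + 1) (by omega)
    exact ⟨N + 1, L, by simp, h1, h2, h3⟩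
  -- A change of labelling alters `h` and the jump sum by opposite amounts.
  have hval : ∀ (g : G) (p : Path x₀ (g • x₀)) n L m M, IsTranslateLabelling W s₀ n L p →
      IsTranslateLabelling W s₀ m M p → val n L g p = val m M g p := by
    intro g p n L m M hL hM
    have e := hh (n, fun k => toOrbit G (L k)) (m, fun k => toOrbit G (M k)) (orbitLoop p)
      hL.isLoopLabelling hM.isLoopLabelling
    have hL' := hL.isLabelling.refine hM.pos
    have hM' := hM.isLabelling.refine hL.pos
    rw [mul_comm] at hM'
    have e2 : labelDiff τY (n, fun k => toOrbit G (L k)) (m, fun k => toOrbit G (M k))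
        (orbitLoop p) = jumpSum τ n L - jumpSum τ m M := by
      rw [← jumpSum_refine hτ₀ hM.pos n L, ← jumpSum_refine hτ₀ hL.pos m M, mul_comm m n,
        ← sum_nodeTerm hτ₀, labelDiff, nodeSum]
      · refine Finset.sum_congr rfl fun k hk => ?_
        rw [Finset.mem_range] at hk
        rw [nodeTerm, nodeTerm, orbitLoop_apply]
        dsimp only
        rw [hcob _ _ _ _ (hL'.mem_pred hk) (hL'.mem_left hk) (hM'.mem_left hk),
          hcob _ _ _ _ (hL'.mem_pred hk) (hM'.mem_pred hk) (hM'.mem_left hk)]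
      · simp [hL.first, hM.first]
      · rw [Nat.mul_sub_one_div hM.pos, mul_comm, Nat.mul_sub_one_div hL.pos, hL.last, hM.last]
    simp only [val]
    rw [← e, e2]
    abel
  choose num lab hlab using hlabel
  have hhom : ∀ (g : G) (p q : Path x₀ (g • x₀)),
      val (num g p) (lab g p) g p = val (num g q) (lab g q) g q := by
    intro g p q
    obtain ⟨H⟩ := SimplyConnectedSpace.paths_homotopic p q
    have hHc : Continuous fun u => H.eval u := Path.continuous_uncurry_iff.1 H.continuous
    have hωc : Continuous fun u => orbitLoop (H.eval u) := by
      refine Path.continuous_uncurry_iff.1 ?_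
      exact (continuous_quotient_mk' (s := MulAction.orbitRel G X)).comp H.continuous
    -- A labelling stays valid for nearby stages of the homotopy. With it fixed, the jump sum is
    -- fixed and `h` is locally constant.
    have hlc : IsLocallyConstant fun u =>
        val (num g (H.eval u)) (lab g (H.eval u)) g (H.eval u) := by
      refine (IsLocallyConstant.iff_eventually_eq _).2 fun u => ?_
      have hu := hlab g (H.eval u)
      have e1 := hh' ⟨_, hωc⟩ (num g (H.eval u), fun k => toOrbit G (lab g (H.eval u) k)) u
        hu.isLoopLabelling
      have e2 := hHc.continuousAt.eventually
        ((isOpen_setOf_isLabelling hW.isOpen _ _ _ _).mem_nhds hu.isLabelling)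
      filter_upwards [e1, e2] with u' h1 h2
      rw [hval g _ _ _ _ _ (hlab g (H.eval u')) ⟨hu.pos, hu.first, hu.last, h2⟩]
      exact congrArg (· + _) h1
    have := hlc.apply_eq_of_preconnectedSpace 0 1
    simpa using this
  let B : G → A := fun g =>
    val (num g (PathConnectedSpace.somePath x₀ (g • x₀)))
      (lab g (PathConnectedSpace.somePath x₀ (g • x₀))) g (PathConnectedSpace.somePath x₀ (g • x₀))
  have hB : ∀ (g : G) (p : Path x₀ (g • x₀)) n L, IsTranslateLabelling W s₀ n L p →
      B g = val n L g p := fun g p n L hL =>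
    (hhom g _ p).trans (hval g p _ _ _ _ (hlab g p) hL)
  refine ⟨B, fun γ η s z hz hηz hηs hηε => ?_⟩
  -- Compare a path through `z` with the one whose second half is moved by `φ η`. As `z` is fixed
  -- the latter is still a path, and both have the same labelled loop below; only the jump sums
  -- differ.
  obtain ⟨a⟩ := PathConnectedSpace.joined x₀ z
  obtain ⟨b⟩ := PathConnectedSpace.joined z (φ γ • x₀)
  obtain ⟨N₁, h₁⟩ := exists_isLabelling hW.isOpen hW.exists_mem a hx₀ hz
  obtain ⟨N₂, h₂⟩ := exists_isLabelling hW.isOpen hW.exists_mem b hz (hW.smul_mem (φ γ) hx₀)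
  obtain ⟨n, hn, hn₁, hn₂⟩ : ∃ n, 0 < n ∧ N₁ ≤ n ∧ N₂ ≤ n := ⟨N₁ + N₂ + 1, by omega⟩
  obtain ⟨L, hL₀, hL₁, hL⟩ := h₁ n hn₁
  obtain ⟨M, hM₀, hM₁, hM⟩ := h₂ n hn₂
  let b' : Path z (φ (η * γ) • x₀) := (b.map (continuous_const_smul (φ η))).cast hηz.symm
    (by rw [map_mul, mul_smul])
  have hb' : ∀ t, b' t = φ η • b t := fun t => rfl
  have hM' : IsLabelling W n (fun k => φ η • M k) b' := fun k hk t h1 h2 =>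
    hW.smul_mem (φ η) (hM k hk t h1 h2)
  have hP : IsTranslateLabelling W s₀ (n + n) (fun k => if k < n then L k else M (k - n))
      (a.trans b) := by
    refine ⟨by omega, by simp [hn, hL₀], ?_, hL.trans hM⟩
    rw [if_neg (by omega), ← hM₁]
    congr 1
    omega
  have hP' : IsTranslateLabelling W s₀ (n + n)
      (fun k => if k < n then L k else φ η • M (k - n)) (a.trans b') := by
    refine ⟨by omega, by simp [hn, hL₀], ?_, hL.trans hM'⟩
    rw [if_neg (by omega), map_mul, mul_smul, ← hM₁]
    congr 2
    omega
  have hloop : orbitLoop (a.trans b') = orbitLoop (a.trans b) := by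
    ext t
    rw [orbitLoop_apply, orbitLoop_apply, Path.trans_apply, Path.trans_apply]
    split_ifs
    · rfl
    · rw [hb', toOrbit_smul]
  have hlabels : (fun k => toOrbit G (if k < n then L k else φ η • M (k - n))) =
      fun k => toOrbit G (if k < n then L k else M (k - n)) := by
    funext k
    split_ifs
    · rfl
    · exact toOrbit_smul _ _
  have hjump : jumpSum τ n (fun k => φ η • M k) = jumpSum τ n M + ε η (φ γ • s₀) := by
    have : ∀ k ∈ Finset.range n, τ (φ η • M (k - 1)) (φ η • M k) =
        τ (M (k - 1)) (M k) + (ε η (M k) - ε η (M (k - 1))) := fun k hk =>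
      hτ η _ _ _ (hM.mem_pred (Finset.mem_range.1 hk)) (hM.mem_left (Finset.mem_range.1 hk))
    rw [jumpSum, Finset.sum_congr rfl this, Finset.sum_add_distrib,
      sum_range_sub_pred (fun k => ε η (M k)), hM₁, hM₀, hηε, sub_zero]
    rfl
  rw [hB _ _ _ _ hP, hB _ _ _ _ hP']
  simp only [val]
  rw [hloop, hlabels, jumpSum_concat hτ₀ hn (hL₁.trans hM₀.symm),
    jumpSum_concat (M := fun k => φ η • M k) hτ₀ hn (by rw [hL₁, hM₀, hηs]), hjump, hε]
  abel

end Holonomy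

/-! ### Cochains of a central extension split over stabilizers -/

section CentralExtension

variable {G S : Type*} [Group G] [MulAction G S]

/-- If a normal subgroup contains all stabilizers, then the quotient by it is the target of an
equivariant map. -/
theorem exists_equivariant_map_quotient (N : Subgroup G) [N.Normal]
    (hN : ∀ s : S, MulAction.stabilizer G s ≤ N) :
    ∃ f : S → G ⧸ N, ∀ (g : G) s, f (g • s) = QuotientGroup.mk' N g * f s := by
  have hrep : ∀ s : S, ∃ g : G, g • (toOrbit G s).out = s := fun s =>
    toOrbit_eq_iff.1 (Quotient.out_eq _).symm
  choose c hc using hrep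
  -- The element `c s` is determined up to the stabilizer of the orbit representative, which lies in
  -- `N`.
  refine ⟨fun s => QuotientGroup.mk' N (c s), fun g s => ?_⟩
  rw [← map_mul]
  refine QuotientGroup.eq.2 (hN (toOrbit G s).out ?_)
  have := hc (g • s)
  rw [toOrbit_smul] at this
  rw [MulAction.mem_stabilizer_iff, mul_smul, mul_smul, hc, inv_smul_eq_iff, this]

theorem sub_eq_sub_add_sub_of_add_eq_add {A : Type*} [AddCommGroup A] {a a' b b' c c' d : A}
    (h : a + b = c + d) (h' : a' + b' = c' + d) : c' - c = b' - b + (a' - a) := by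
  rw [← sub_eq_iff_eq_add] at h h'
  rw [← h, ← h']
  abel

variable {Γ : Type*} [Group Γ]

instance : CommGroup (Subgroup.center Γ) where
  mul_comm a b := Subtype.ext (Subgroup.mem_center_iff.1 b.2 a)

theorem exists_map_smul_out {T : Type*} [MulAction G T] (φ : Γ →* G) (hφ : Function.Surjective φ)
    (s : T) : ∃ γ : Γ, φ γ • (toOrbit G s).out = s := by
  obtain ⟨g, hg⟩ := toOrbit_eq_iff.1 (Quotient.out_eq (toOrbit G s)).symm
  obtain ⟨γ, rfl⟩ := hφ g
  exact ⟨γ, hg⟩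

/-- Let `φ : Γ → G` be a central extension with compatible equivariant splittings over all
stabilizers of a `G`-set `S`. Then there are a cocycle `ε` on `Γ` and a cochain `τ` on `S`
which measure the failure of the splittings to come from a splitting of `φ`. -/
theorem exists_splitting_cochains (φ : Γ →* G) (hφ : Function.Surjective φ)
    (hcen : φ.ker ≤ Subgroup.center Γ) (sec : ∀ s : S, MulAction.stabilizer G s →* Γ)
    (hsec : ∀ s h, φ (sec s h) = h)
    (hconj : ∀ γ s (h : G) (hs : h ∈ MulAction.stabilizer G s)
      (hs' : φ γ * h * (φ γ)⁻¹ ∈ MulAction.stabilizer G (φ γ • s)),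
      γ * sec s ⟨h, hs⟩ * γ⁻¹ = sec (φ γ • s) ⟨_, hs'⟩)
    (adj : S → S → Prop) (hadj : ∀ (g : G) s t, adj s t → adj (g • s) (g • t))
    (hcompat : ∀ s t (h : G) (hs : h ∈ MulAction.stabilizer G s)
      (ht : h ∈ MulAction.stabilizer G t), adj s t → sec s ⟨h, hs⟩ = sec t ⟨h, ht⟩) :
    ∃ (ε : Γ → S → Additive (Subgroup.center Γ)) (τ : S → S → Additive (Subgroup.center Γ)),
      (∀ s, τ s s = 0) ∧ (∀ γ γ' s, ε (γ * γ') s = ε γ (φ γ' • s) + ε γ' s) ∧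
      (∀ γ s t, adj s t → τ (φ γ • s) (φ γ • t) = τ s t + (ε γ t - ε γ s)) ∧
      (∀ s h, ε (sec s h) s = 0) ∧ ∀ k s, φ k = 1 → ((ε k s).toMul : Γ) = k := by
  classical
  have hker : ∀ {s γ} (h : φ γ ∈ MulAction.stabilizer G s),
      γ * (sec s ⟨φ γ, h⟩)⁻¹ ∈ Subgroup.center Γ := fun h =>
    hcen (by rw [MonoidHom.mem_ker, map_mul, map_inv, hsec, mul_inv_cancel])
  -- The central discrepancy between `γ` and the split lift of `φ γ`; it is meaningful only over the
  -- stabilizer of `s`, and 0 is a dummy value elsewhere.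
  let ρ : S → Γ → Additive (Subgroup.center Γ) := fun s γ =>
    if h : φ γ ∈ MulAction.stabilizer G s then Additive.ofMul ⟨_, hker h⟩ else 0
  have hρ : ∀ {s γ} (h : φ γ ∈ MulAction.stabilizer G s),
      ((ρ s γ).toMul : Γ) = γ * (sec s ⟨φ γ, h⟩)⁻¹ := fun h => by
    simp only [ρ, dif_pos h, toMul_ofMul]
  have hext : ∀ {a b : Additive (Subgroup.center Γ)}, (a.toMul : Γ) = b.toMul → a = b := fun h =>
    Additive.toMul.injective (Subtype.ext h)
  have hρmul : ∀ s γ γ', φ γ ∈ MulAction.stabilizer G s → φ γ' ∈ MulAction.stabilizer G s →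
      ρ s (γ * γ') = ρ s γ + ρ s γ' := by
    intro s γ γ' h h'
    have hm : φ (γ * γ') ∈ MulAction.stabilizer G s := by
      rw [map_mul]
      exact mul_mem h h'
    refine hext ?_
    rw [hρ hm, toMul_add, Subgroup.coe_mul, hρ h, hρ h']
    have e : sec s ⟨φ (γ * γ'), hm⟩ = sec s ⟨φ γ, h⟩ * sec s ⟨φ γ', h'⟩ := by
      rw [← map_mul]
      exact congrArg _ (Subtype.ext (map_mul φ γ γ'))
    have hc := Subgroup.mem_center_iff.1 (hker h') (sec s ⟨φ γ, h⟩)⁻¹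
    rw [e, mul_inv_rev, mul_assoc γ (sec s ⟨φ γ, h⟩)⁻¹, hc]
    group
  have hρconj : ∀ s γ δ, φ δ ∈ MulAction.stabilizer G s →
      ρ (φ γ • s) (γ * δ * γ⁻¹) = ρ s δ := by
    intro s γ δ h
    have hm : φ γ * φ δ * (φ γ)⁻¹ ∈ MulAction.stabilizer G (φ γ • s) := by
      rw [MulAction.mem_stabilizer_iff, smul_smul, inv_mul_cancel_right, mul_smul,
        MulAction.mem_stabilizer_iff.1 h]
    have hm' : φ (γ * δ * γ⁻¹) ∈ MulAction.stabilizer G (φ γ • s) := by simpa using hm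
    refine hext ?_
    rw [hρ hm', hρ h]
    have e : sec (φ γ • s) ⟨φ (γ * δ * γ⁻¹), hm'⟩ = γ * sec s ⟨φ δ, h⟩ * γ⁻¹ := by
      rw [hconj γ s _ h hm]
      exact congrArg _ (Subtype.ext (by simp))
    have hc := Subgroup.mem_center_iff.1 (hker h) γ
    rw [e]
    calc _ = γ * (δ * (sec s ⟨φ δ, h⟩)⁻¹) * γ⁻¹ := by group
      _ = _ := by rw [hc, mul_inv_cancel_right]
  have hrep : ∀ s : S, ∃ γ : Γ, φ γ • (toOrbit G s).out = s := exists_map_smul_out φ hφ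
  choose l hl using hrep
  -- Transport by `l` turns any `γ` into an element over the stabilizer of the orbit representative.
  -- Where `φ γ` fixes `s`, conjugation invariance gives back `ρ s γ`.
  let ε : Γ → S → Additive (Subgroup.center Γ) := fun γ s =>
    ρ (toOrbit G s).out ((l (φ γ • s))⁻¹ * γ * l s)
  have hstab : ∀ γ s, φ ((l (φ γ • s))⁻¹ * γ * l s) ∈
      MulAction.stabilizer G (toOrbit G s).out := by
    intro γ s
    have := hl (φ γ • s)
    rw [toOrbit_smul] at this
    rw [MulAction.mem_stabilizer_iff, map_mul, map_mul, mul_smul, mul_smul, hl, map_inv,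
      inv_smul_eq_iff, this]
  have hε : ∀ γ γ' s, ε (γ * γ') s = ε γ (φ γ' • s) + ε γ' s := by
    intro γ γ' s
    have h := hstab γ (φ γ' • s)
    rw [toOrbit_smul] at h
    simp only [ε]
    rw [toOrbit_smul, ← hρmul _ _ _ h (hstab γ' s), map_mul, mul_smul]
    congr 1
    group
  have hεfix : ∀ γ s, φ γ • s = s → ε γ s = ρ s γ := by
    intro γ s h
    have h1 := hstab γ s
    have h2 := hρconj _ (l s) _ h1
    simp only [ε]
    rw [← h2, hl, h]
    congr 1
    group
  have hrepP : ∀ s : S × S, ∃ γ : Γ, φ γ • (toOrbit G s).out = s := exists_map_smul_out φ hφ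
  choose m hm using hrepP
  -- The required change of `τ` under translation suggests setting it to 0 on a representative of
  -- each orbit of pairs and transporting by `m`. On adjacent pairs the choice is harmless: an
  -- element fixing both members has equal `ε` there.
  refine ⟨ε, fun s t => ε (m (s, t)) (toOrbit G (s, t)).out.2 -
    ε (m (s, t)) (toOrbit G (s, t)).out.1, fun s => ?_, hε, fun γ s t hst => ?_, fun s h => ?_,
    fun k s hk => ?_⟩
  · have h := hm (s, s)
    have h1 : φ (m (s, s)) • (toOrbit G (s, s)).out.1 = s := congrArg Prod.fst h
    have h2 : φ (m (s, s)) • (toOrbit G (s, s)).out.2 = s := congrArg Prod.snd h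
    dsimp only
    rw [smul_left_cancel _ (h2.trans h1.symm), sub_self]
  · have horb : toOrbit G (φ γ • s, φ γ • t) = toOrbit G (s, t) := toOrbit_smul (φ γ) (s, t)
    have h := hm (s, t)
    have h' := hm (φ γ • s, φ γ • t)
    dsimp only
    rw [horb] at h' ⊢
    set r := (toOrbit G (s, t)).out
    set μ := m (s, t)
    set μ' := m (φ γ • s, φ γ • t)
    have h1 : φ μ • r.1 = s := congrArg Prod.fst h
    have h2 : φ μ • r.2 = t := congrArg Prod.snd h
    have h1' : φ μ' • r.1 = φ γ • s := congrArg Prod.fst h'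
    have h2' : φ μ' • r.2 = φ γ • t := congrArg Prod.snd h'
    have hδ : γ * μ = μ' * (μ'⁻¹ * γ * μ) := by group
    have hf1 : φ (μ'⁻¹ * γ * μ) • r.1 = r.1 := by
      rw [map_mul, map_mul, mul_smul, mul_smul, h1, map_inv, inv_smul_eq_iff, h1']
    have hf2 : φ (μ'⁻¹ * γ * μ) • r.2 = r.2 := by
      rw [map_mul, map_mul, mul_smul, mul_smul, h2, map_inv, inv_smul_eq_iff, h2']
    have e1 : ε γ s + ε μ r.1 = ε μ' r.1 + ε (μ'⁻¹ * γ * μ) r.1 := by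
      have := hε γ μ r.1
      rwa [h1, hδ, hε, hf1, eq_comm] at this
    have e2 : ε γ t + ε μ r.2 = ε μ' r.2 + ε (μ'⁻¹ * γ * μ) r.2 := by
      have := hε γ μ r.2
      rwa [h2, hδ, hε, hf2, eq_comm] at this
    have hadj' : adj r.1 r.2 := by
      have := hadj (φ μ)⁻¹ s t hst
      rwa [← h1, ← h2, inv_smul_smul, inv_smul_smul] at this
    have e3 : ε (μ'⁻¹ * γ * μ) r.1 = ε (μ'⁻¹ * γ * μ) r.2 := by
      rw [hεfix _ _ hf1, hεfix _ _ hf2]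
      refine hext ?_
      rw [hρ hf1, hρ hf2, hcompat _ _ _ hf1 hf2 hadj']
    exact sub_eq_sub_add_sub_of_add_eq_add e1 (e3 ▸ e2)
  · have hf : φ (sec s h) • s = s := by rw [hsec]; exact h.2
    rw [hεfix _ _ hf]
    refine hext ?_
    rw [hρ hf, toMul_zero, Subgroup.coe_one, mul_inv_eq_one]
    exact congrArg _ (Subtype.ext (hsec s h).symm)
  · have hf : φ k • s = s := by rw [hk, one_smul]
    rw [hεfix _ _ hf, hρ hf]
    have : (⟨φ k, hf⟩ : MulAction.stabilizer G s) = 1 := Subtype.ext hk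
    rw [this, map_one, inv_one, mul_one]

end CentralExtension

/-! ### The amalgam as a central extension, and the conclusion -/

namespace AbstractSimplicialComplex

variable {G V : Type*} [Group G] [MulAction G V] (X : AbstractSimplicialComplex V)

variable (G) in
/-- The quotient of the free product of the stabilizers by the edge and conjugation relations. -/
abbrev StabilizerAmalgam : Type _ :=
  StabilizerProduct V G ⧸ relatorSubgroup G X

/-- The image of `g ∈ G_v` in the amalgam. -/
def amalgamOf (v : V) : MulAction.stabilizer G v →* StabilizerAmalgam G X :=
  (QuotientGroup.mk' (relatorSubgroup G X)).comp
    (Monoid.CoprodI.of (M := fun v : V => MulAction.stabilizer G v) (i := v))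

variable (G) in
/-- The canonical homomorphism to `G`. -/
def amalgamToGroup : StabilizerAmalgam G X →* G :=
  QuotientGroup.lift (relatorSubgroup G X)
    (Monoid.CoprodI.lift fun v : V => (MulAction.stabilizer G v).subtype) (by
      refine Subgroup.normalClosure_le_normal ?_
      rintro r (⟨e, he, -, v, -, v', -, -, g, -, hv, hv', rfl⟩ | ⟨v, w, g, h, rfl⟩)
      · simp [MonoidHom.mem_ker]
      · simp [MonoidHom.mem_ker, conjStab])

variable {X}

@[simp]
theorem amalgamToGroup_of (v : V) (g : MulAction.stabilizer G v) :
    amalgamToGroup G X (amalgamOf X v g) = g := by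
  change Monoid.CoprodI.lift (fun v : V => (MulAction.stabilizer G v).subtype) (stabElt v g) = _
  rw [Monoid.CoprodI.lift_of]
  rfl

theorem StabilizerAmalgam.induction_left {P : StabilizerAmalgam G X → Prop}
    (γ : StabilizerAmalgam G X) (one : P 1)
    (mul : ∀ v (g : MulAction.stabilizer G v) γ, P γ → P (amalgamOf X v g * γ)) : P γ := by
  induction γ using QuotientGroup.induction_on with | _ w =>
  induction w using Monoid.CoprodI.induction_left with
  | one => exact one
  | mul m x ih => exact mul _ m _ ih

theorem amalgamOf_congr {v w : V} (h : v = w) {g k : G} (e : g = k)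
    (hg : g ∈ MulAction.stabilizer G v) (hk : k ∈ MulAction.stabilizer G w) :
    amalgamOf X v ⟨g, hg⟩ = amalgamOf X w ⟨k, hk⟩ := by
  subst h e
  rfl

theorem amalgamOf_conj_of (v w : V) (g : MulAction.stabilizer G v) (h : MulAction.stabilizer G w) :
    amalgamOf X v g * amalgamOf X w h * (amalgamOf X v g)⁻¹ =
      amalgamOf X ((g : G) • w) (conjStab (g : G) w h) := by
  rw [← mul_inv_eq_one]
  have : stabElt v g * stabElt w h * (stabElt v g)⁻¹ *
      (stabElt ((g : G) • w) (conjStab (g : G) w h))⁻¹ ∈ relatorSubgroup G X :=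
    Subgroup.subset_normalClosure (Or.inr ⟨v, w, g, h, rfl⟩)
  exact (QuotientGroup.eq_one_iff _).2 this

/-- The conjugation relations cover conjugation by one generator; iterating them over a word shows
that Γ permutes the generators through `G`. -/
theorem amalgamOf_conj (γ : StabilizerAmalgam G X) (w : V) (h : MulAction.stabilizer G w) :
    γ * amalgamOf X w h * γ⁻¹ =
      amalgamOf X (amalgamToGroup G X γ • w) (conjStab (amalgamToGroup G X γ) w h) := by
  induction γ using StabilizerAmalgam.induction_left with
  | one =>
    simp only [one_mul, inv_one, mul_one]
    exact amalgamOf_congr (by simp) (by simp) _ _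
  | mul v g γ ih =>
    calc _ = amalgamOf X v g * (γ * amalgamOf X w h * γ⁻¹) * (amalgamOf X v g)⁻¹ := by group
      _ = _ := by
        rw [ih, amalgamOf_conj_of]
        refine amalgamOf_congr ?_ ?_ _ _
        · rw [map_mul, amalgamToGroup_of, mul_smul]
        · simp only [conjStab, map_mul, amalgamToGroup_of]
          group

/-- By `amalgamOf_conj`, an element of the kernel conjugates each generator to itself. -/
theorem ker_amalgamToGroup_le_center :
    (amalgamToGroup G X).ker ≤ Subgroup.center (StabilizerAmalgam G X) := by
  intro k hk
  rw [MonoidHom.mem_ker] at hk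
  have hgen : ∀ w (h : MulAction.stabilizer G w), amalgamOf X w h * k = k * amalgamOf X w h := by
    intro w h
    have := amalgamOf_conj k w h
    have e : amalgamOf X (amalgamToGroup G X k • w) (conjStab (amalgamToGroup G X k) w h) =
        amalgamOf X w h := amalgamOf_congr (by rw [hk, one_smul]) (by simp [hk]) _ _
    rw [e, mul_inv_eq_iff_eq_mul] at this
    exact this.symm
  refine Subgroup.mem_center_iff.2 fun γ => ?_
  induction γ using StabilizerAmalgam.induction_left with
  | one => simp
  | mul v g γ ih => rw [mul_assoc, ih, ← mul_assoc, hgen, mul_assoc]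

/-- The image is generated by the vertex stabilizers, which `G` permutes by conjugation. -/
instance : (amalgamToGroup G X).range.Normal := by
  refine ⟨?_⟩
  rintro _ ⟨γ, rfl⟩ g
  induction γ using StabilizerAmalgam.induction_left with
  | one => simp
  | mul v h γ ih =>
    have : g * amalgamToGroup G X (amalgamOf X v h * γ) * g⁻¹ =
        amalgamToGroup G X (amalgamOf X (g • v) (conjStab g v h)) *
          (g * amalgamToGroup G X γ * g⁻¹) := by
      rw [map_mul, amalgamToGroup_of, amalgamToGroup_of, conjStab]
      group
    rw [this]
    exact mul_mem ⟨_, rfl⟩ ih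

/-- The vertex `v` as a simplex. -/
def vertexFace (X : AbstractSimplicialComplex V) (v : V) : X.faces :=
  ⟨{v}, X.singleton_mem v⟩

/-- The vertex `v` as a point of the realization. -/
noncomputable def vertexPoint (X : AbstractSimplicialComplex V) (v : V) : X.Realization where
  coord := Finsupp.single v 1
  nonneg w := by
    classical
    rw [Finsupp.single_apply]
    split_ifs <;> norm_num
  sum_eq_one := by simp
  support_mem := by
    rw [Finsupp.support_single v one_ne_zero]
    exact X.singleton_mem v

theorem vertexPoint_mem_baryStar (v : V) : X.vertexPoint v ∈ X.baryStar (X.vertexFace v) := by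
  have h : X.vertexFace v = ⟨(X.vertexPoint v).coord.support, (X.vertexPoint v).support_mem⟩ :=
    Subtype.ext (Finsupp.support_single v one_ne_zero).symm
  rw [h]
  exact mem_baryStar_support _

variable [IsSimplicialAction G X]

theorem smul_vertexPoint {g : G} {v : V} (h : g • v = v) :
    g • X.vertexPoint v = X.vertexPoint v := by
  classical
  refine Realization.ext (Finsupp.ext fun w => ?_)
  rw [smul_coord]
  change Finsupp.single v (1 : ℝ) _ = Finsupp.single v 1 _
  rw [Finsupp.single_apply, Finsupp.single_apply, eq_inv_smul_iff, h]

theorem smul_vertexFace {g : G} {v : V} (h : g • v = v) :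
    g • X.vertexFace v = X.vertexFace v := by
  refine Subtype.ext ?_
  rw [coe_smul_face]
  simp [vertexFace, h]

instance : ContinuousConstSMul G X.Realization :=
  ⟨continuous_smul_realization⟩

variable (G X) in
theorem isSliceCover_baryStar : IsSliceCover G X.baryStar where
  isOpen := isOpen_baryStar
  exists_mem x := ⟨_, mem_baryStar_support x⟩
  smul_mem g _ _ hx := smul_mem_baryStar g hx
  smul_eq := smul_face_eq_of_mem_baryStar

namespace WithoutRotations

theorem smul_eq (hrot : WithoutRotations G X) {s : X.faces} {g : G}
    (hg : g ∈ MulAction.stabilizer G s) {v : V} (hv : v ∈ (s : Finset V)) :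
    g ∈ MulAction.stabilizer G v :=
  hrot s s.2 g (congrArg Subtype.val hg) v hv

/-- Two distinct vertices of `s` span an edge, and without rotations `g` fixes both of them, so an
edge relation applies. -/
theorem amalgamOf_eq (hrot : WithoutRotations G X) {s : X.faces} {g : G}
    (hg : g ∈ MulAction.stabilizer G s) {v w : V} (hv : v ∈ (s : Finset V))
    (hw : w ∈ (s : Finset V)) :
    amalgamOf X v ⟨g, hrot.smul_eq hg hv⟩ = amalgamOf X w ⟨g, hrot.smul_eq hg hw⟩ := by
  classical
  by_cases hvw : v = w
  · exact amalgamOf_congr hvw rfl _ _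
  rw [← mul_inv_eq_one]
  suffices h : stabElt v ⟨g, hrot.smul_eq hg hv⟩ * (stabElt w ⟨g, hrot.smul_eq hg hw⟩)⁻¹ ∈
      relatorSubgroup G X from (QuotientGroup.eq_one_iff _).2 h
  refine Subgroup.subset_normalClosure (Or.inl
    ⟨{v, w}, (X.isRelLowerSet_faces s.2).2 ?_ (by simp), Finset.card_pair hvw, v, by simp, w,
      by simp, hvw, g, ?_, hrot.smul_eq hg hv, hrot.smul_eq hg hw, rfl⟩)
  · intro u hu
    rcases Finset.mem_insert.1 hu with rfl | hu
    · exact hv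
    · exact (Finset.mem_singleton.1 hu) ▸ hw
  · rw [Finset.map_insert, Finset.map_singleton]
    have h1 : g • v = v := hrot.smul_eq hg hv
    have h2 : g • w = w := hrot.smul_eq hg hw
    simp [h1, h2]

/-- The homomorphism from the stabilizer of a simplex to the amalgam. -/
noncomputable def faceHom (hrot : WithoutRotations G X) (s : X.faces) :
    MulAction.stabilizer G s →* StabilizerAmalgam G X :=
  (amalgamOf X (X.isRelLowerSet_faces s.2).1.choose).comp
    (Subgroup.inclusion fun _ hg => hrot.smul_eq hg (X.isRelLowerSet_faces s.2).1.choose_spec)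

theorem faceHom_apply (hrot : WithoutRotations G X) {s : X.faces}
    (g : MulAction.stabilizer G s) {v : V} (hv : v ∈ (s : Finset V)) :
    hrot.faceHom s g = amalgamOf X v ⟨(g : G), hrot.smul_eq g.2 hv⟩ :=
  hrot.amalgamOf_eq g.2 (X.isRelLowerSet_faces s.2).1.choose_spec hv

theorem amalgamToGroup_surjective (hrot : WithoutRotations G X) [PathConnectedSpace X.Realization]
    [SimplyConnectedSpace (OrbitSpace G X)] : Function.Surjective (amalgamToGroup G X) := by
  obtain ⟨f, hf⟩ := exists_equivariant_map_quotient (S := X.faces) (amalgamToGroup G X).range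
    fun s g hg => by
      obtain ⟨v, hv⟩ := (X.isRelLowerSet_faces s.2).1
      exact ⟨amalgamOf X v ⟨g, hrot.smul_eq hg hv⟩, amalgamToGroup_of _ _⟩
  intro g
  have := (isSliceCover_baryStar G X).map_eq_one _ f hf g
  rwa [QuotientGroup.mk'_apply, QuotientGroup.eq_one_iff] at this

theorem amalgamToGroup_injective (hrot : WithoutRotations G X) [SimplyConnectedSpace X.Realization]
    (hquot : IsTwoConnected (OrbitSpace G X)) : Function.Injective (amalgamToGroup G X) := by
  have := hquot.simplyConnected
  have hsurj := hrot.amalgamToGroup_surjective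
  obtain ⟨ε, τ, hτ₀, hε, hτ, hεsec, hεker⟩ := exists_splitting_cochains (amalgamToGroup G X) hsurj
    ker_amalgamToGroup_le_center hrot.faceHom
    (fun s h => amalgamToGroup_of _ _)
    (fun γ s h hs hs' => by
      obtain ⟨v, hv⟩ := (X.isRelLowerSet_faces s.2).1
      have hv' : amalgamToGroup G X γ • v ∈ ((amalgamToGroup G X γ • s : X.faces) : Finset V) :=
        mem_smul_face.2 (by simpa using hv)
      rw [hrot.faceHom_apply _ hv, hrot.faceHom_apply _ hv', amalgamOf_conj]
      rfl)
    -- Comparability is implied by meeting stars, and it supplies a common vertex through which the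
    -- two splittings agree.
    (fun s t => (s : Finset V) ⊆ t ∨ (t : Finset V) ⊆ s)
    (fun g s t h => h.imp Finset.map_subset_map.2 Finset.map_subset_map.2)
    (fun s t h hs ht hst => by
      rcases hst with hst | hst
      · obtain ⟨v, hv⟩ := (X.isRelLowerSet_faces s.2).1
        rw [hrot.faceHom_apply _ hv, hrot.faceHom_apply _ (hst hv)]
      · obtain ⟨v, hv⟩ := (X.isRelLowerSet_faces t.2).1
        rw [hrot.faceHom_apply _ hv, hrot.faceHom_apply _ (hst hv)])
  obtain ⟨x₀⟩ := (inferInstance : Nonempty X.Realization)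
  obtain ⟨B, hB⟩ := (isSliceCover_baryStar G X).exists_holonomy hquot (amalgamToGroup G X) hsurj
    ε τ hτ₀ hε (fun γ x s t hs ht => hτ γ s t (subset_or_subset_of_mem_baryStar hs ht))
    _ ⟨x₀, mem_baryStar_support x₀⟩
  set s₀ : X.faces := ⟨x₀.coord.support, x₀.support_mem⟩
  -- Each generator fixes its vertex as a point of |X| and is a value of the splitting over that
  -- vertex, so `ε` vanishes on it there.
  have hconst : ∀ γ, B (amalgamToGroup G X γ) - ε γ s₀ = B (amalgamToGroup G X 1) - ε 1 s₀ := by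
    intro γ
    induction γ using StabilizerAmalgam.induction_left with
    | one => rfl
    | mul v g γ ih =>
      have hg : (g : G) ∈ MulAction.stabilizer G (X.vertexFace v) := smul_vertexFace g.2
      have hgen : amalgamOf X v g = hrot.faceHom (X.vertexFace v) ⟨g, hg⟩ :=
        (hrot.faceHom_apply ⟨_, hg⟩ (Finset.mem_singleton_self v)).symm
      rw [hB γ _ (X.vertexFace v) (X.vertexPoint v) (vertexPoint_mem_baryStar v), ih]
      · rw [amalgamToGroup_of]
        exact smul_vertexPoint g.2
      · rw [amalgamToGroup_of]
        exact hg
      · rw [hgen, hεsec]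
  refine (injective_iff_map_eq_one _).2 fun k hk => ?_
  have h := hconst k
  rw [hk, map_one, sub_right_inj] at h
  rw [← hεker k s₀ hk, h, hεker 1 s₀ (map_one _)]

end WithoutRotations

end AbstractSimplicialComplex

/-- If `G` acts without rotations on a simply connected simplicial complex `X` and `X/G` is
`2`-connected, then the homomorphism from the free product of all vertex stabilizers to `G` that
sends `g_v` to `g` induces an isomorphism of the quotient by the edge relations and the
conjugation relations with `G`. -/
theorem theorem1p1 {G V : Type*} [Group G] [MulAction G V]
    (X : AbstractSimplicialComplex V) [IsSimplicialAction G X]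
    (hrot : WithoutRotations G X)
    (hX : SimplyConnectedSpace X.Realization)
    (hquot : IsTwoConnected (OrbitSpace G X)) :
    ∃ e : StabilizerProduct V G ⧸ relatorSubgroup G X ≃* G,
      ∀ (v : V) (g : MulAction.stabilizer G v),
        e (QuotientGroup.mk (stabElt v g)) = (g : G) := by
  have := hquot.simplyConnected
  exact ⟨MulEquiv.ofBijective (amalgamToGroup G X)
    ⟨hrot.amalgamToGroup_injective hquot, hrot.amalgamToGroup_surjective⟩,
      amalgamToGroup_of (X := X)⟩
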